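/- Let $\mathcal H$ be an infinite-dimensional separable real Hilbert space, write $(a\otimes b)\zeta=\langle a,\zeta\rangle b$, and let $\|\cdot\|_{op}$, $\|\cdot\|_{HS}$ be the operator and Hilbert–Schmidt norms. Let $x_t,y_t,z_t$ ($t\ge 1$) be random elements of $\mathcal H$, let $\mathcal A,\mathcal B$ be bounded linear operators on $\mathcal H$, and put $u_t=y_t-\mathcal A x_t$, $v_t=x_t-\mathcal B z_t$. For processes $a,b$ let $\widehat{\mathcal C}_{ab}=T^{-1}\sum_{t=1}^T a_t\otimes b_t$ and $\mathcal C_{ab}=\mathbb E[a_t\otimes b_t]$. Let $\mathcal C_{zz}=\sum_j\mu_j\,g_j\otimes g_j$ and $\mathcal Q=\mathcal C_{xz}^*\mathcal C_{zz}^{-1}\mathcal C_{xz}=\sum_j\nu_j\,h_j\otimes h_j$ be spectral decompositions with orthonormal bases $(g_j)$, $(h_j)$; here $\mathcal Q$ is the bounded operator $\sum_j\mu_j^{-1}(\mathcal C_{xz}^*g_j)\otimes(\mathcal C_{xz}^*g_j)$. **Basic assumptions.** (i) $(x_t,z_t)$ is strictly stationary and geometrically strongly mixing, $x_t,z_t$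 have mean zero, and $x_t,z_t,u_t$ are square integrable. (ii) With $\mathfrak F_{t-1}=\sigma(\{z_s\}_{s\le t},\{u_s\}_{s\le t-1})$: $\mathbb E[u_t\mid\mathfrak F_{t-1}]=0$, $\mathbb E[u_t\otimes u_t\mid\mathfrak F_{t-1}]=\mathcal C_{uu}$, and for some $\delta>0$, $\sup_{1\le t\le T}\mathbb E[\|u_t\|^{2+\delta}\mid\mathfrak F_{t-1}]<\infty$ almost surely for each $T$. (iii) $\mathbb E[z_t\otimes v_t]=0$. (iv) $\ker\mathcal Q=\{0\}$ and $\|\mathcal A\|_{HS}<\infty$. (v) $\mu_1>\mu_2>\dots>0$ and $\nu_1>\nu_2>\dots>0$. (vi) $\|\widehat{\mathcal C}_{xz}-\mathcal C_{xz}\|_{HS}$, $\|\widehat{\mathcal C}_{zz}-\mathcal C_{zz}\|_{HS}$, $\|\widehat{\mathcal C}_{uz}-\mathcal C_{uz}\|_{HS}$ and $\|\widehat{\mathcal C}_{vz}\|_{HS}$ are $O_p(T^{-1/2})$, and $\|\widehat{\mathcal C}_{uu}-\mathcal C_{uu}\|_{HS}=o_p(1)$. **Rate assumptions.** There are constants $c>0$,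 $\rho_\mu,\rho_\nu>2$, $\varsigma_\mu,\varsigma_\nu,\gamma_\mu,\gamma_\nu>1/2$ and $m>1$ such that for all $j,\ell\ge1$, all $t\ge 1$ and all lags $1\le s<t$: $\mu_j^2\le c\,j^{-\rho_\mu}$ and $\mu_j^2-\mu_{j+1}^2\ge c^{-1}j^{-\rho_\mu-1}$; $\nu_j^2\le c\,j^{-\rho_\nu}$ and $\nu_j^2-\nu_{j+1}^2\ge c^{-1}j^{-\rho_\nu-1}$; $|\langle h_j,\mathcal A h_\ell\rangle|\le c\,j^{-\gamma_\nu}\ell^{-\varsigma_\nu}$; $|\langle h_j,\mathcal B g_\ell\rangle|\le c\,j^{-\gamma_\mu}\ell^{-\varsigma_\mu}$; with $\tilde\upsilon_t(j,\ell)=\langle z_t,g_j\rangle\langle z_t,g_\ell\rangle-\mathbb E[\langle z_t,g_j\rangle\langle z_t,g_\ell\rangle]$, $\mathbb E[\tilde\upsilon_t(j,\ell)\tilde\upsilon_{t-s}(j,\ell)]\le c\,s^{-m}\,\mathbb E[\tilde\upsilon_t(j,\ell)^2]$; $\mathbb E\|\langle z_t,g_j\rangle z_t\|^2\le c\,\mu_j$;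 and $\mathbb E\|\langle x_t,h_j\rangle z_t\|^2\le c\,\nu_j$. **Estimator.** For an operator $\mathcal T$ with eigenelements ordered from the largest eigenvalue to the smallest, $\mathcal T_K^{-1}$ denotes the inverse restricted to the first $K$ eigenelements. Let $\widehat\mu_j$ be the ordered eigenvalues of $\widehat{\mathcal C}_{zz}$, $K_1=\#\{j:\widehat\mu_j^2>\alpha_1\}$, $\widehat{\mathcal P}=\widehat{\mathcal C}_{yz}^*(\widehat{\mathcal C}_{zz})_{K_1}^{-1}\widehat{\mathcal C}_{xz}$, $\widehat{\mathcal Q}=\widehat{\mathcal C}_{xz}^*(\widehat{\mathcal C}_{zz})_{K_1}^{-1}\widehat{\mathcal C}_{xz}$, let $(\widehat\nu_j,\widehat h_j)$ be the ordered eigenelements of $\widehat{\mathcal Q}$, $K_2=\#\{j:\widehat\nu_j^2>\alpha_2\}$, $\widetilde{\mathcal A}=\widehat{\mathcal P}\,\widehat{\mathcal Q}_{K_2}^{-1}$ (the F2SLSE) and $\widetilde\Pi_{K_2}=\sum_{j\le K_2}\widehat h_j\otimes\widehat h_j$. **Theorem.** Suppose that these assumptions hold and that the positive deterministic $\alpha_1=\alpha_1(T)\to0$,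 $\alpha_2=\alpha_2(T)\to0$ satisfy $\alpha_1^{-1}=o(T^{\rho_\mu/(2\rho_\mu+2)})$ and $\alpha_2^{-1}=o(\alpha_1^{-\rho_\nu/(2\rho_\nu+2)})$ as $T\to\infty$. Then $$\|\widetilde{\mathcal A}-\mathcal A\widetilde\Pi_{K_2}\|_{op}^2=O_p(T^{-1}\alpha_1^{-1/2}\alpha_2^{-1/2}),$$ $$\|\mathcal A(\mathcal I-\widetilde\Pi_{K_2})\|_{op}^2=O_p\big(\alpha_1\alpha_2^{-1}\max\{1,\alpha_2^{(2\varsigma_\nu-3)/\rho_\nu}\}+\alpha_2^{(2\varsigma_\nu-1)/\rho_\nu}\big),$$ and consequently $\|\widetilde{\mathcal A}-\mathcal A\|_{op}=o_p(1)$. -/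

import Mathlib

open MeasureTheory Filter Topology Asymptotics
open scoped ENNReal RealInnerProductSpace InnerProduct

noncomputable section

namespace FIV

variable {H : Type*} [NormedAddCommGroup H] [InnerProductSpace ℝ H]

/-! ### Operators on a real Hilbert space -/

/-- The tensor product of two vectors, `(a ⊗ b) ζ = ⟪a, ζ⟫ b`. -/
def tens (a b : H) : H →L[ℝ] H := (innerSL ℝ a).smulRight b

/-- The Hilbert-Schmidt norm `(∑ j, ‖S e_j‖ ^ 2) ^ (1/2)`; the sum has the same value for every
orthonormal basis `e`, so the supremum is over equal numbers. -/
def hsNorm (S : H →L[ℝ] H) : ℝ≥0∞ :=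
  (⨆ e : HilbertBasis ℕ ℝ H, ∑' j, ‖S (e j)‖ₑ ^ 2) ^ (1 / 2 : ℝ)

/-- `(lam j, e j)`, `j = 0, 1, …`, are the eigenelements of `S`: the eigenvalues are listed from
the largest to the smallest (with multiplicity), the eigenvectors form an orthonormal basis. -/
structure IsEigensystem (S : H →L[ℝ] H) (lam : ℕ → ℝ) (e : HilbertBasis ℕ ℝ H) : Prop where
  antitone : Antitone lam
  eigen : ∀ j, S (e j) = lam j • e j

/-- Regularized inverse based on the first `K` eigenelements, `∑_{j ≤ K} lam_j⁻¹ e_j ⊗ e_j`. -/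
def regInv (lam : ℕ → ℝ) (e : HilbertBasis ℕ ℝ H) (K : ℕ) : H →L[ℝ] H :=
  ∑ j ∈ Finset.range K, (lam j)⁻¹ • tens (e j) (e j)

/-- Orthogonal projection onto the span of the first `K` eigenvectors, `∑_{j ≤ K} e_j ⊗ e_j`. -/
def firstProj (e : HilbertBasis ℕ ℝ H) (K : ℕ) : H →L[ℝ] H :=
  ∑ j ∈ Finset.range K, tens (e j) (e j)

/-- `#{j : lam_j ^ 2 > α}`. -/
def truncCount (lam : ℕ → ℝ) (α : ℝ) : ℕ := Set.ncard {j : ℕ | α < lam j ^ 2}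

/-! ### Probabilistic notions -/

variable {Ω : Type*} [MeasurableSpace Ω]

/-- `X_T = O_p(r_T)` as `T → ∞`, for nonnegative `X_T`. -/
def IsBigOp (P : Measure Ω) (X : ℕ → Ω → ℝ≥0∞) (r : ℕ → ℝ) : Prop :=
  ∀ ε : ℝ, 0 < ε → ∃ M : ℝ, ∀ᶠ T in atTop,
    P {ω | ENNReal.ofReal (M * r T) < X T ω} ≤ ENNReal.ofReal ε

/-- `X_T = o_p(1)` as `T → ∞`, for nonnegative `X_T`. -/
def IsLittleOpOne (P : Measure Ω) (X : ℕ → Ω → ℝ≥0∞) : Prop :=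
  ∀ ε : ℝ, 0 < ε → Tendsto (fun T => P {ω | ENNReal.ofReal ε < X T ω}) atTop (𝓝 0)

/-- Strict stationarity: the law of the whole sequence is invariant under time shifts. -/
def IsStationarySeq {E : Type*} [MeasurableSpace E] (P : Measure Ω) (w : ℕ → Ω → E) : Prop :=
  ∀ s : ℕ, P.map (fun ω t => w (t + s) ω) = P.map (fun ω t => w t ω)

/-- Geometric strong mixing: the strong mixing coefficients between `σ(w_s, s ≤ t)` and
`σ(w_s, s ≥ t + k)` are bounded by `C r ^ k` for some `r < 1`, uniformly in `t`. -/
def IsGeomStrongMixing {E : Type*} [MeasurableSpace E] (P : Measure Ω) (w : ℕ → Ω → E) : Prop :=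
  ∃ C r : ℝ, 0 ≤ r ∧ r < 1 ∧ ∀ (t k : ℕ) (S U : Set Ω),
    MeasurableSet[⨆ s ∈ Set.Iic t, MeasurableSpace.comap (w s) inferInstance] S →
    MeasurableSet[⨆ s ∈ Set.Ici (t + k), MeasurableSpace.comap (w s) inferInstance] U →
    |P.real (S ∩ U) - P.real S * P.real U| ≤ C * r ^ k

/-- `E[a ⊗ b]`. -/
def momentOp (P : Measure Ω) (a b : Ω → H) : H →L[ℝ] H := ∫ ω, tens (a ω) (b ω) ∂P

/-- `T⁻¹ ∑_t a_t ⊗ b_t`; the `T` observations are those with index `0, …, T - 1`. -/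
def sampleOp (a b : ℕ → Ω → H) (T : ℕ) (ω : Ω) : H →L[ℝ] H :=
  (T : ℝ)⁻¹ • ∑ t ∈ Finset.range T, tens (a t ω) (b t ω)

/-- The error `b_t - S a_t` of the linear model `b_t = S a_t + error`. -/
def resid (S : H →L[ℝ] H) (a b : ℕ → Ω → H) (t : ℕ) (ω : Ω) : H := b t ω - S (a t ω)

/-- The information preceding `u_t`: the σ-field generated by `z_s`, `s ≤ t`, and `u_s`,
`s < t`. -/
@[reducible] def pastInfo [MeasurableSpace H] (z u : ℕ → Ω → H) (t : ℕ) : MeasurableSpace Ω :=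
  (⨆ s ∈ Set.Iic t, MeasurableSpace.comap (z s) inferInstance) ⊔
    (⨆ s ∈ Set.Iio t, MeasurableSpace.comap (u s) inferInstance)

/-! ### The population operator `Q` and the estimator -/

variable [CompleteSpace H]

/-- `Q = C_xz* C_zz⁻¹ C_xz`, where `C_zz⁻¹ = ∑_j μ_j⁻¹ g_j ⊗ g_j` and `(μ_j, g_j)` are the
eigenelements of `C_zz`; since `C_xz* (g_j ⊗ g_j) C_xz = (C_xz* g_j) ⊗ (C_xz* g_j)`, this is the
following series in the Banach space of bounded operators. It converges absolutely whenever
`x` and `z` are square integrable. -/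
def popQ (Cxz : H →L[ℝ] H) (μ : ℕ → ℝ) (g : HilbertBasis ℕ ℝ H) : H →L[ℝ] H :=
  ∑' j, (μ j)⁻¹ • tens ((Cxz†) (g j)) ((Cxz†) (g j))

/-- `Q̂ = Ĉ_xz* (Ĉ_zz)_{K₁}⁻¹ Ĉ_xz`, where `K₁ = #{j : μ̂_j ^ 2 > α₁}` and `(μ̂_j, ĝ_j)` are
the eigenelements of `Ĉ_zz`. -/
def sampleQ (x z : ℕ → Ω → H) (α₁ : ℕ → ℝ) (μh : ℕ → Ω → ℕ → ℝ)
    (gh : ℕ → Ω → HilbertBasis ℕ ℝ H) (T : ℕ) (ω : Ω) : H →L[ℝ] H :=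
  (sampleOp x z T ω)† ∘L regInv (μh T ω) (gh T ω) (truncCount (μh T ω) (α₁ T)) ∘L
    sampleOp x z T ω

/-- `P̂ = Ĉ_yz* (Ĉ_zz)_{K₁}⁻¹ Ĉ_xz`. -/
def sampleP (x y z : ℕ → Ω → H) (α₁ : ℕ → ℝ) (μh : ℕ → Ω → ℕ → ℝ)
    (gh : ℕ → Ω → HilbertBasis ℕ ℝ H) (T : ℕ) (ω : Ω) : H →L[ℝ] H :=
  (sampleOp y z T ω)† ∘L regInv (μh T ω) (gh T ω) (truncCount (μh T ω) (α₁ T)) ∘L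
    sampleOp x z T ω

/-- The functional two-stage least square estimator `Ã = P̂ Q̂_{K₂}⁻¹`, where
`K₂ = #{j : ν̂_j ^ 2 > α₂}` and `(ν̂_j, ĥ_j)` are the eigenelements of `Q̂`. -/
def f2slse (x y z : ℕ → Ω → H) (α₁ α₂ : ℕ → ℝ) (μh : ℕ → Ω → ℕ → ℝ)
    (gh : ℕ → Ω → HilbertBasis ℕ ℝ H) (νh : ℕ → Ω → ℕ → ℝ)
    (hh : ℕ → Ω → HilbertBasis ℕ ℝ H) (T : ℕ) (ω : Ω) : H →L[ℝ] H :=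
  sampleP x y z α₁ μh gh T ω ∘L regInv (νh T ω) (hh T ω) (truncCount (νh T ω) (α₂ T))

/-- `Π̃_{K₂} = ∑_{j ≤ K₂} ĥ_j ⊗ ĥ_j`. -/
def projTilde (α₂ : ℕ → ℝ) (νh : ℕ → Ω → ℕ → ℝ) (hh : ℕ → Ω → HilbertBasis ℕ ℝ H)
    (T : ℕ) (ω : Ω) : H →L[ℝ] H :=
  firstProj (hh T ω) (truncCount (νh T ω) (α₂ T))

/-! ### Assumptions -/

variable [MeasurableSpace H]

/-- The basic assumptions on the observations `(x_t, y_t, z_t)`, the regression operator `A`, the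
first-stage operator `B`, the eigenelements `(μ_j, g_j)` of `C_zz = E[z ⊗ z]` and the
eigenelements `(ν_j, h_j)` of `Q`. The errors are `u_t = y_t - A x_t` and `v_t = x_t - B z_t`. -/
structure BasicAssumption (P : Measure Ω) (x y z : ℕ → Ω → H) (A B : H →L[ℝ] H)
    (μ : ℕ → ℝ) (g : HilbertBasis ℕ ℝ H) (ν : ℕ → ℝ) (h : HilbertBasis ℕ ℝ H) : Prop where
  measurable_x : ∀ t, Measurable (x t)
  measurable_y : ∀ t, Measurable (y t)
  measurable_z : ∀ t, Measurable (z t)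
  stationary : IsStationarySeq P (fun t ω => (x t ω, z t ω))
  mixing : IsGeomStrongMixing P (fun t ω => (x t ω, z t ω))
  memLp_x : ∀ t, MemLp (x t) 2 P
  memLp_z : ∀ t, MemLp (z t) 2 P
  memLp_u : ∀ t, MemLp (resid A x y t) 2 P
  mean_x : ∀ t, ∫ ω, x t ω ∂P = 0
  mean_z : ∀ t, ∫ ω, z t ω ∂P = 0
  /-- `E[u_t | past] = 0`. -/
  martingale_diff : ∀ t, P[resid A x y t | pastInfo z (resid A x y) t] =ᵐ[P] 0
  /-- `E[u_t ⊗ u_t | past] = C_uu`. -/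
  homoscedastic : ∀ t,
    P[fun ω => tens (resid A x y t ω) (resid A x y t ω) | pastInfo z (resid A x y) t]
      =ᵐ[P] fun _ => momentOp P (resid A x y 0) (resid A x y 0)
  /-- `sup_{t ≤ T} E[‖u_t‖ ^ (2 + δ) | past] < ∞`. -/
  cond_moment : ∃ δ : ℝ, 0 < δ ∧ ∀ T : ℕ, ∀ᵐ ω ∂P,
    ⨆ t ∈ Finset.range T,
      condLExp (pastInfo z (resid A x y) t) P (fun ω' => ‖resid A x y t ω'‖ₑ ^ (2 + δ)) ω < ∞
  /-- The first-stage errors `v_t` are uncorrelated with `z_t`. -/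
  first_stage : ∀ t, momentOp P (z t) (resid B z x t) = 0
  eigen_zz : IsEigensystem (momentOp P (z 0) (z 0)) μ g
  eigen_Q : IsEigensystem (popQ (momentOp P (x 0) (z 0)) μ g) ν h
  strictAnti_μ : StrictAnti μ
  pos_μ : ∀ j, 0 < μ j
  strictAnti_ν : StrictAnti ν
  pos_ν : ∀ j, 0 < ν j
  ker_Q : (popQ (momentOp P (x 0) (z 0)) μ g).ker = ⊥
  hs_A : hsNorm A < ∞
  rate_xz : IsBigOp P (fun T ω => hsNorm (sampleOp x z T ω - momentOp P (x 0) (z 0)))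
    (fun T => (T : ℝ) ^ (-(1 / 2) : ℝ))
  rate_zz : IsBigOp P (fun T ω => hsNorm (sampleOp z z T ω - momentOp P (z 0) (z 0)))
    (fun T => (T : ℝ) ^ (-(1 / 2) : ℝ))
  rate_uz : IsBigOp P
    (fun T ω => hsNorm (sampleOp (resid A x y) z T ω - momentOp P (resid A x y 0) (z 0)))
    (fun T => (T : ℝ) ^ (-(1 / 2) : ℝ))
  rate_uu : IsLittleOpOne P
    (fun T ω => hsNorm (sampleOp (resid A x y) (resid A x y) T ω -
      momentOp P (resid A x y 0) (resid A x y 0)))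
  rate_vz : IsBigOp P (fun T ω => hsNorm (sampleOp (resid B z x) z T ω))
    (fun T => (T : ℝ) ^ (-(1 / 2) : ℝ))

/-- `⟪z_t, g_j⟫ ⟪z_t, g_l⟫ - E[⟪z_t, g_j⟫ ⟪z_t, g_l⟫]`. -/
def scoreDev (P : Measure Ω) (z : ℕ → Ω → H) (g : HilbertBasis ℕ ℝ H) (j l t : ℕ) (ω : Ω) : ℝ :=
  ⟪z t ω, g j⟫ * ⟪z t ω, g l⟫ - ∫ ω', ⟪z t ω', g j⟫ * ⟪z t ω', g l⟫ ∂P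

/-- The refined assumptions, with polynomial decay and gaps of the eigenvalues of `C_zz` and `Q`
and smoothness of `A` and `B`. Sequences start at index `0`, so that the `j`-th element of the
usual numbering from `1` has index `j - 1`. -/
structure RateAssumption (P : Measure Ω) (x y z : ℕ → Ω → H) (A B : H →L[ℝ] H)
    (μ : ℕ → ℝ) (g : HilbertBasis ℕ ℝ H) (ν : ℕ → ℝ) (h : HilbertBasis ℕ ℝ H)
    (c ρμ ρν ςμ ςν γμ γν m : ℝ) : Prop extends BasicAssumption P x y z A B μ g ν h where
  c_pos : 0 < c
  hρμ : 2 < ρμ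
  hρν : 2 < ρν
  hςμ : 1 / 2 < ςμ
  hςν : 1 / 2 < ςν
  hγμ : 1 / 2 < γμ
  hγν : 1 / 2 < γν
  hm : 1 < m
  decay_μ : ∀ j : ℕ, μ j ^ 2 ≤ c * ((j : ℝ) + 1) ^ (-ρμ)
  gap_μ : ∀ j : ℕ, c⁻¹ * ((j : ℝ) + 1) ^ (-ρμ - 1) ≤ μ j ^ 2 - μ (j + 1) ^ 2
  decay_ν : ∀ j : ℕ, ν j ^ 2 ≤ c * ((j : ℝ) + 1) ^ (-ρν)
  gap_ν : ∀ j : ℕ, c⁻¹ * ((j : ℝ) + 1) ^ (-ρν - 1) ≤ ν j ^ 2 - ν (j + 1) ^ 2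
  smooth_A : ∀ j l : ℕ,
    |⟪h j, A (h l)⟫| ≤ c * ((j : ℝ) + 1) ^ (-γν) * ((l : ℝ) + 1) ^ (-ςν)
  smooth_B : ∀ j l : ℕ,
    |⟪h j, B (g l)⟫| ≤ c * ((j : ℝ) + 1) ^ (-γμ) * ((l : ℝ) + 1) ^ (-ςμ)
  /-- Decay of the lag-`s` autocovariances, `s ≥ 1`. -/
  autocov : ∀ j l t s : ℕ, 1 ≤ s →
    ∫ ω, scoreDev P z g j l (t + s) ω * scoreDev P z g j l t ω ∂P ≤
      c * (s : ℝ) ^ (-m) * ∫ ω, scoreDev P z g j l (t + s) ω ^ 2 ∂P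
  /-- `E[‖⟪z_t, g_j⟫ z_t‖ ^ 2] ≤ c μ_j`. -/
  moment_z : ∀ j t : ℕ, ∫⁻ ω, ‖⟪z t ω, g j⟫ • z t ω‖ₑ ^ 2 ∂P ≤ ENNReal.ofReal (c * μ j)
  /-- `E[‖⟪x_t, h_j⟫ z_t‖ ^ 2] ≤ c ν_j`. -/
  moment_x : ∀ j t : ℕ, ∫⁻ ω, ‖⟪x t ω, h j⟫ • z t ω‖ₑ ^ 2 ∂P ≤ ENNReal.ofReal (c * ν j)

end FIV

end

/-!
Since `v` is uncorrelated with `z`, the operator `Q` is the covariance `B C_zz B*` of the fitted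
values `B z`, and its sample version differs from it by `O_p(√α₁)`: regularizing moves the sample
covariance of `z` by at most `√α₁`, and the remaining terms are `O_p(T^{-1/2})`. The stochastic
error of the estimator is exactly `Ĉ_uz* (Ĉ_zz)_{K₁}⁻¹ Ĉ_xz Q̂_{K₂}⁻¹`, in which the last three
factors collapse to an operator of norm `(α₁ α₂)^{-1/4}`. For the bias, let `Π` project onto the
eigenvectors of `Q` whose eigenvalues are at least twice the sample threshold `√α₂`. These are
separated from the discarded sample eigenvalues by a gap of order `√α₂`, so a one-sided Davis–Kahan
bound compares `Π` with the sample projection and no spacing between individual eigenvalues enters.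
What `Π` misses of `A` is a tail of its coefficients, and the lower bound on the eigenvalues of `Q`
converts its length into a power of `α₂`.
-/

namespace FIV

section Diagonal

variable {ι H : Type*} [NormedAddCommGroup H] [InnerProductSpace ℝ H]
  {e : HilbertBasis ι ℝ H} {d d' : ι → ℝ} {S S' : H →L[ℝ] H} {a : ℝ}

lemma hasSum_sq_inner (e : HilbertBasis ι ℝ H) (v : H) :
    HasSum (fun j => ⟪e j, v⟫ ^ 2) (‖v‖ ^ 2) := by
  simpa only [real_inner_self_eq_norm_sq, real_inner_comm, ← sq] using e.hasSum_inner_mul_inner v v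

/-- `S` is the diagonal operator `∑_j d_j e_j ⊗ e_j` in the orthonormal basis `e`. Operators with a
known eigenbasis, their truncated inverses and their spectral projections all have this form, so
that computations with them reduce to computations with the sequences `d`. -/
def IsDiag (e : HilbertBasis ι ℝ H) (d : ι → ℝ) (S : H →L[ℝ] H) : Prop :=
  ∀ j, S (e j) = d j • e j

namespace IsDiag

lemma ext (hS : IsDiag e d S) (hS' : IsDiag e d' S') (hd : ∀ j, d j = d' j) : S = S' := by
  refine ContinuousLinearMap.ext_on ?_ (s := Set.range e) ?_
  · exact (Submodule.dense_iff_topologicalClosure_eq_top).2 e.dense_span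
  · rintro _ ⟨j, rfl⟩
    rw [hS j, hS' j, hd j]

lemma inner_apply (hS : IsDiag e d S) (j : ι) (v : H) : ⟪e j, S v⟫ = d j * ⟪e j, v⟫ := by
  classical
  have hfun : innerSL ℝ (e j) ∘L S = d j • innerSL ℝ (e j) := by
    refine ContinuousLinearMap.ext_on ?_ (s := Set.range e) ?_
    · exact (Submodule.dense_iff_topologicalClosure_eq_top).2 e.dense_span
    · rintro _ ⟨i, rfl⟩
      rcases eq_or_ne j i with rfl | hji
      · simp [hS j]
      · simp [hS i, e.orthonormal.2 hji]
  exact DFunLike.congr_fun hfun v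

protected lemma id : IsDiag e 1 (ContinuousLinearMap.id ℝ H) := fun j => by simp

lemma sub (hS : IsDiag e d S) (hS' : IsDiag e d' S') : IsDiag e (d - d') (S - S') := fun j => by
  simp [hS j, hS' j, sub_smul]

lemma comp (hS : IsDiag e d S) (hS' : IsDiag e d' S') : IsDiag e (d * d') (S ∘L S') := fun j => by
  simp [hS j, hS' j, smul_smul, mul_comm]

lemma adjoint_eq [CompleteSpace H] (hS : IsDiag e d S) : S† = S :=
  IsDiag.ext (d := d) (fun j => ext_inner_right ℝ fun v => by
    rw [ContinuousLinearMap.adjoint_inner_left, hS.inner_apply, real_inner_smul_left]) hS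
    fun _ => rfl

lemma norm_le (hS : IsDiag e d S) (ha : 0 ≤ a) (hd : ∀ j, |d j| ≤ a) : ‖S‖ ≤ a := by
  refine S.opNorm_le_bound ha fun v => le_of_sq_le_sq ?_ (by positivity)
  rw [mul_pow]
  refine hasSum_le (fun j => ?_) (hasSum_sq_inner e (S v)) ((hasSum_sq_inner e v).mul_left (a ^ 2))
  rw [hS.inner_apply, mul_pow]
  exact mul_le_mul_of_nonneg_right (sq_le_sq' (neg_le_of_abs_le (hd j)) (le_of_abs_le (hd j)))
    (sq_nonneg _)

lemma norm_apply_sq_le (hS : IsDiag e d S) (h0 : ∀ j, 0 ≤ d j) (hd : ∀ j, d j ≤ a) (v : H) :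
    ‖S v‖ ^ 2 ≤ a * ⟪v, S v⟫ := by
  refine hasSum_le (fun j => ?_) (hasSum_sq_inner e (S v))
    ((e.hasSum_inner_mul_inner v (S v)).mul_left a)
  calc ⟪e j, S v⟫ ^ 2 = d j * (d j * ⟪e j, v⟫ ^ 2) := by rw [hS.inner_apply]; ring
    _ ≤ a * (d j * ⟪e j, v⟫ ^ 2) :=
      mul_le_mul_of_nonneg_right (hd j) (mul_nonneg (h0 j) (sq_nonneg _))
    _ = a * (⟪v, e j⟫ * ⟪e j, S v⟫) := by rw [hS.inner_apply, real_inner_comm]; ring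

end IsDiag

end Diagonal

section Spectral

variable {H : Type*} [NormedAddCommGroup H] [InnerProductSpace ℝ H]
  {e e' : HilbertBasis ℕ ℝ H} {lam lam' : ℕ → ℝ} {S S' : H →L[ℝ] H} {K K' : ℕ} {t α : ℝ}

@[simp] lemma tens_apply (a b v : H) : tens a b v = ⟪a, v⟫ • b := rfl

lemma isDiag_regInv (lam : ℕ → ℝ) (e : HilbertBasis ℕ ℝ H) (K : ℕ) :
    IsDiag e (fun j => if j < K then (lam j)⁻¹ else 0) (regInv lam e K) := fun j => by
  simp [regInv, orthonormal_iff_ite.1 e.orthonormal]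

lemma isDiag_firstProj (e : HilbertBasis ℕ ℝ H) (K : ℕ) :
    IsDiag e (fun j => if j < K then 1 else 0) (firstProj e K) := fun j => by
  simp [firstProj, orthonormal_iff_ite.1 e.orthonormal]

lemma isDiag_compl_firstProj (e : HilbertBasis ℕ ℝ H) (K : ℕ) :
    IsDiag e (fun j => if j < K then 0 else 1) (ContinuousLinearMap.id ℝ H - firstProj e K) := by
  convert IsDiag.id.sub (isDiag_firstProj e K) using 2 with j
  split_ifs <;> simp [*]

lemma norm_firstProj_le_one (e : HilbertBasis ℕ ℝ H) (K : ℕ) : ‖firstProj e K‖ ≤ 1 :=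
  (isDiag_firstProj e K).norm_le zero_le_one fun j => by split_ifs <;> simp

lemma norm_compl_firstProj_le_one (e : HilbertBasis ℕ ℝ H) (K : ℕ) :
    ‖ContinuousLinearMap.id ℝ H - firstProj e K‖ ≤ 1 :=
  (isDiag_compl_firstProj e K).norm_le zero_le_one fun j => by split_ifs <;> simp

lemma norm_regInv_le (e : HilbertBasis ℕ ℝ H) (ht : 0 < t) (hlam : ∀ j < K, t ≤ lam j) :
    ‖regInv lam e K‖ ≤ t⁻¹ :=
  (isDiag_regInv lam e K).norm_le (inv_nonneg.2 ht.le) fun j => by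
    split_ifs with hj
    · rw [abs_inv, abs_of_pos (ht.trans_le (hlam j hj))]
      exact inv_anti₀ ht (hlam j hj)
    · simpa using ht.le

lemma norm_regInv_apply_sq_le (e : HilbertBasis ℕ ℝ H) (ht : 0 < t) (hlam : ∀ j < K, t ≤ lam j)
    (v : H) : ‖regInv lam e K v‖ ^ 2 ≤ t⁻¹ * ⟪v, regInv lam e K v⟫ := by
  refine (isDiag_regInv lam e K).norm_apply_sq_le (fun j => ?_) (fun j => ?_) v
  · split_ifs with hj
    · exact inv_nonneg.2 (ht.le.trans (hlam j hj))
    · exact le_rfl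
  · split_ifs with hj
    · exact inv_anti₀ ht (hlam j hj)
    · exact inv_nonneg.2 ht.le

lemma norm_comp_comp_le (S S' S'' : H →L[ℝ] H) : ‖S ∘L S' ∘L S''‖ ≤ ‖S‖ * (‖S'‖ * ‖S''‖) :=
  (S.opNorm_comp_le _).trans (by gcongr; exact S'.opNorm_comp_le _)

namespace IsEigensystem

lemma isDiag (hS : IsEigensystem S lam e) : IsDiag e lam S := hS.eigen

lemma comp_regInv (hS : IsEigensystem S lam e) (hlam : ∀ j < K, lam j ≠ 0) :
    S ∘L regInv lam e K = firstProj e K :=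
  (hS.isDiag.comp (isDiag_regInv lam e K)).ext (isDiag_firstProj e K) fun j => by
    by_cases hj : j < K <;> simp [hj, hlam]

lemma regInv_comp (hS : IsEigensystem S lam e) (hlam : ∀ j < K, lam j ≠ 0) :
    regInv lam e K ∘L S = firstProj e K :=
  ((isDiag_regInv lam e K).comp hS.isDiag).ext (isDiag_firstProj e K) fun j => by
    by_cases hj : j < K <;> simp [hj, hlam]

lemma norm_comp_compl_firstProj_le (hS : IsEigensystem S lam e) (ht : 0 ≤ t)
    (hlam : ∀ j, K ≤ j → |lam j| ≤ t) :
    ‖S ∘L (ContinuousLinearMap.id ℝ H - firstProj e K)‖ ≤ t :=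
  (hS.isDiag.comp (isDiag_compl_firstProj e K)).norm_le ht fun j => by
    by_cases hj : j < K
    · simpa [hj] using ht
    · simpa [hj] using hlam j (not_lt.1 hj)

lemma tendsto_zero (hS : IsEigensystem S lam e)
    (h : Tendsto (fun j => S (e j)) atTop (𝓝 0)) : Tendsto lam atTop (𝓝 0) := by
  have hnorm := h.norm
  simp only [hS.eigen, norm_smul, e.orthonormal.1, mul_one, norm_zero] at hnorm
  exact tendsto_zero_iff_norm_tendsto_zero.2 hnorm

end IsEigensystem

lemma lt_truncCount_iff (hl : Antitone lam) (h0 : Tendsto lam atTop (𝓝 0)) (hα : 0 < α) (j : ℕ) :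
    j < truncCount lam α ↔ α < lam j ^ 2 := by
  have hsq : Antitone fun j => lam j ^ 2 := fun i j hij =>
    pow_le_pow_left₀ (hl.le_of_tendsto h0 j) (hl hij) 2
  have hsq0 : Tendsto (fun j => lam j ^ 2) atTop (𝓝 0) := by simpa using h0.pow 2
  have hfin : {j | α < lam j ^ 2}.Finite := by
    obtain ⟨n, hn⟩ := (hsq0.eventually (gt_mem_nhds hα)).exists
    exact (Set.finite_lt_nat n).subset fun i hi =>
      lt_of_not_ge fun hni => (hi.trans_le (hsq hni)).not_gt hn
  refine ⟨fun hj => ?_, fun hj => ?_⟩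
  · by_contra! hle
    refine hj.not_ge ?_
    calc truncCount lam α ≤ (Set.Iio j).ncard := Set.ncard_le_ncard (fun i hi =>
          lt_of_not_ge fun hji => (hi.trans_le (hsq hji)).not_ge hle) (Set.finite_Iio j)
      _ = j := Set.ncard_Iio_nat j
  · calc j < (Set.Iio (j + 1)).ncard := by simp
      _ ≤ truncCount lam α := Set.ncard_le_ncard (fun i hi =>
          hj.trans_le (hsq (Nat.lt_succ_iff.1 hi))) hfin

lemma sqrt_le_of_lt_truncCount (hl : Antitone lam) (h0 : Tendsto lam atTop (𝓝 0)) (hα : 0 < α)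
    {j : ℕ} (hj : j < truncCount lam α) : √α ≤ lam j :=
  (Real.sqrt_le_left (hl.le_of_tendsto h0 j)).2 ((lt_truncCount_iff hl h0 hα j).1 hj).le

lemma abs_le_sqrt_of_truncCount_le (hl : Antitone lam) (h0 : Tendsto lam atTop (𝓝 0))
    (hα : 0 < α) {j : ℕ} (hj : truncCount lam α ≤ j) : |lam j| ≤ √α :=
  Real.abs_le_sqrt (not_lt.1 (mt (lt_truncCount_iff hl h0 hα j).2 hj.not_gt))

/-- A one-sided Davis–Kahan bound: `N = P ∘ (1 - P')` solves the Sylvester equation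
`S N - N S' = P (S - S') (1 - P')`, whose left side has norm at least `(2 t - t) ‖N‖`. -/
lemma norm_firstProj_comp_compl_le (hS : IsEigensystem S lam e) (hS' : IsEigensystem S' lam' e')
    (ht : 0 < t) (h : ∀ j < K, 2 * t ≤ lam j) (h' : ∀ j, K' ≤ j → |lam' j| ≤ t) :
    t * ‖firstProj e K ∘L (ContinuousLinearMap.id ℝ H - firstProj e' K')‖ ≤ ‖S' - S‖ := by
  set R := regInv lam e K
  set C := ContinuousLinearMap.id ℝ H - firstProj e' K'
  set N := firstProj e K ∘L C
  have hRS : R ∘L S = firstProj e K := hS.regInv_comp fun j hj =>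
    ((mul_pos two_pos ht).trans_le (h j hj)).ne'
  have hRN : R ∘L firstProj e K = R :=
    ((isDiag_regInv lam e K).comp (isDiag_firstProj e K)).ext (isDiag_regInv lam e K)
      fun j => by by_cases hj : j < K <;> simp [hj]
  have hCS' : C ∘L S' ∘L C = S' ∘L C :=
    have hC := isDiag_compl_firstProj e' K'
    (hC.comp (hS'.isDiag.comp hC)).ext (hS'.isDiag.comp hC) fun j => by
      by_cases hj : j < K' <;> simp [hj]
  have hN : N = R ∘L N ∘L (S' ∘L C) - R ∘L (S' - S) ∘L C := by
    calc N = R ∘L S ∘L C := by rw [← ContinuousLinearMap.comp_assoc, hRS]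
      _ = R ∘L (S' ∘L C) - R ∘L (S' - S) ∘L C := by
        rw [ContinuousLinearMap.sub_comp S' S, ContinuousLinearMap.comp_sub R, sub_sub_cancel]
      _ = (R ∘L firstProj e K) ∘L (C ∘L S' ∘L C) - R ∘L (S' - S) ∘L C := by rw [hRN, hCS']
      _ = R ∘L N ∘L (S' ∘L C) - R ∘L (S' - S) ∘L C := by
        simp only [N, ContinuousLinearMap.comp_assoc]
  have hle : ‖N‖ ≤ (2 * t)⁻¹ * (‖N‖ * t) + (2 * t)⁻¹ * (‖S' - S‖ * 1) := by
    have hR : ‖R‖ ≤ (2 * t)⁻¹ := norm_regInv_le e (by positivity) h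
    have hS'C : ‖S' ∘L C‖ ≤ t := hS'.norm_comp_compl_firstProj_le ht.le h'
    calc ‖N‖ ≤ ‖R ∘L N ∘L (S' ∘L C)‖ + ‖R ∘L (S' - S) ∘L C‖ := by
          conv_lhs => rw [hN]
          exact norm_sub_le _ _
      _ ≤ ‖R‖ * (‖N‖ * ‖S' ∘L C‖) + ‖R‖ * (‖S' - S‖ * ‖C‖) :=
        add_le_add (norm_comp_comp_le _ _ _) (norm_comp_comp_le _ _ _)
      _ ≤ _ := by gcongr; exact norm_compl_firstProj_le_one e' K'
  have hhalf : (2 * t)⁻¹ * (‖N‖ * t) = ‖N‖ / 2 := by field_simp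
  have hdiv : (2 * t)⁻¹ * (‖S' - S‖ * 1) = ‖S' - S‖ / t / 2 := by field_simp
  rw [mul_comm, ← le_div_iff₀ ht]
  linarith

lemma norm_comp_compl_firstProj_le_add (hS : IsEigensystem S lam e)
    (hS' : IsEigensystem S' lam' e') (ht : 0 < t) (h : ∀ j < K, 2 * t ≤ lam j)
    (h' : ∀ j, K' ≤ j → |lam' j| ≤ t) (A : H →L[ℝ] H) :
    ‖A ∘L (ContinuousLinearMap.id ℝ H - firstProj e' K')‖ ≤
      ‖A‖ * (‖S' - S‖ / t) + ‖A ∘L (ContinuousLinearMap.id ℝ H - firstProj e K)‖ := by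
  set C := ContinuousLinearMap.id ℝ H - firstProj e K
  set C' := ContinuousLinearMap.id ℝ H - firstProj e' K'
  have hsplit : A ∘L C' = A ∘L (firstProj e K ∘L C') + (A ∘L C) ∘L C' := by
    ext v; simp [C]
  calc ‖A ∘L C'‖ ≤ ‖A‖ * ‖firstProj e K ∘L C'‖ + ‖A ∘L C‖ * ‖C'‖ := by
        rw [hsplit]
        exact (norm_add_le _ _).trans
          (add_le_add (A.opNorm_comp_le _) ((A ∘L C).opNorm_comp_le _))
    _ ≤ ‖A‖ * (‖S' - S‖ / t) + ‖A ∘L C‖ * 1 := by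
        gcongr
        · rw [le_div_iff₀ ht, mul_comm]
          exact norm_firstProj_comp_compl_le hS hS' ht h h'
        · exact norm_compl_firstProj_le_one e' K'
    _ = ‖A‖ * (‖S' - S‖ / t) + ‖A ∘L C‖ := by rw [mul_one]

end Spectral

section HilbertSchmidt

variable {ι H : Type*} [NormedAddCommGroup H] [InnerProductSpace ℝ H] [CompleteSpace H]

lemma norm_adjoint_eq (S : H →L[ℝ] H) : ‖S†‖ = ‖S‖ := LinearIsometryEquiv.norm_map _ S

lemma norm_sq_le_of_sum_norm_sq_le (S : H →L[ℝ] H) (e : HilbertBasis ι ℝ H) {C : ℝ}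
    (hS : ∀ F : Finset ι, ∑ j ∈ F, ‖S (e j)‖ ^ 2 ≤ C) : ‖S‖ ^ 2 ≤ C := by
  have hC : 0 ≤ C := by simpa using hS ∅
  have hadj : ‖S†‖ ≤ √C := by
    refine (S†).opNorm_le_bound (Real.sqrt_nonneg C) fun w => ?_
    refine le_of_sq_le_sq ?_ (by positivity)
    rw [mul_pow, Real.sq_sqrt hC]
    refine hasSum_le_of_sum_le (hasSum_sq_inner e ((S†) w)) fun F => ?_
    calc ∑ j ∈ F, ⟪e j, (S†) w⟫ ^ 2 ≤ ∑ j ∈ F, ‖S (e j)‖ ^ 2 * ‖w‖ ^ 2 :=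
          Finset.sum_le_sum fun j _ => by
            rw [ContinuousLinearMap.adjoint_inner_right, ← mul_pow, ← sq_abs]
            exact pow_le_pow_left₀ (abs_nonneg _) (abs_real_inner_le_norm _ _) 2
      _ ≤ C * ‖w‖ ^ 2 := by
          rw [← Finset.sum_mul]
          exact mul_le_mul_of_nonneg_right (hS F) (sq_nonneg _)
  rw [norm_adjoint_eq] at hadj
  exact (Real.le_sqrt (norm_nonneg S) hC).1 hadj

lemma enorm_sq_le_tsum_enorm_sq (S : H →L[ℝ] H) (e : HilbertBasis ι ℝ H) :
    ‖S‖ₑ ^ 2 ≤ ∑' j, ‖S (e j)‖ₑ ^ 2 := by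
  by_cases hfin : ∑' j, ‖S (e j)‖ₑ ^ 2 = ∞
  · exact hfin ▸ le_top
  · rw [← ofReal_norm, ← ENNReal.ofReal_pow (norm_nonneg S)]
    refine ENNReal.ofReal_le_of_le_toReal (norm_sq_le_of_sum_norm_sq_le S e fun F => ?_)
    calc ∑ j ∈ F, ‖S (e j)‖ ^ 2 = (∑ j ∈ F, ‖S (e j)‖ₑ ^ 2).toReal := by
          rw [ENNReal.toReal_sum fun j _ => by simp]
          simp
      _ ≤ _ := ENNReal.toReal_mono hfin (ENNReal.sum_le_tsum F)

lemma enorm_le_hsNorm (S : H →L[ℝ] H) (e : HilbertBasis ℕ ℝ H) : ‖S‖ₑ ≤ hsNorm S := by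
  calc ‖S‖ₑ = (‖S‖ₑ ^ 2) ^ (1 / 2 : ℝ) := by
        rw [one_div]
        exact (ENNReal.pow_rpow_inv_natCast two_ne_zero _).symm
    _ ≤ hsNorm S := ENNReal.rpow_le_rpow ((enorm_sq_le_tsum_enorm_sq S e).trans
        (le_iSup (fun e : HilbertBasis ℕ ℝ H => ∑' j, ‖S (e j)‖ₑ ^ 2) e)) (by norm_num)

end HilbertSchmidt

section PolynomialDecay

lemma le_of_rpow_le_sub_succ {a : ℕ → ℝ} {k ρ : ℝ} (hk : 0 ≤ k) (hρ : -1 ≤ ρ)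
    (ha : ∀ j, 0 ≤ a j)
    (hgap : ∀ j : ℕ, k * ((j : ℝ) + 1) ^ (-ρ - 1) ≤ a j - a (j + 1)) (j : ℕ) :
    k * 2 ^ (-ρ - 1) * ((j : ℝ) + 1) ^ (-ρ) ≤ a j := by
  have hj : (0 : ℝ) < (j : ℝ) + 1 := by positivity
  calc k * 2 ^ (-ρ - 1) * ((j : ℝ) + 1) ^ (-ρ)
      = ∑ _i ∈ Finset.range (j + 1), k * (2 * ((j : ℝ) + 1)) ^ (-ρ - 1) := by
        rw [Finset.sum_const, Finset.card_range, nsmul_eq_mul,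
          Real.mul_rpow zero_le_two hj.le, Real.rpow_sub_one hj.ne' (-ρ)]
        push_cast
        field_simp
    _ ≤ ∑ i ∈ Finset.range (j + 1), (a (j + i) - a (j + (i + 1))) := by
        refine Finset.sum_le_sum fun i hi => le_trans ?_ (hgap (j + i))
        have hij : (i : ℝ) ≤ j := by exact_mod_cast Nat.lt_succ_iff.1 (Finset.mem_range.1 hi)
        refine mul_le_mul_of_nonneg_left ?_ hk
        exact Real.rpow_le_rpow_of_nonpos (by positivity) (by push_cast; linarith) (by linarith)
    _ = a j - a (j + (j + 1)) := Finset.sum_range_sub' (fun i => a (j + i)) (j + 1)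
    _ ≤ a j := sub_le_self _ (ha _)

lemma summable_nat_add_one_rpow {s : ℝ} (hs : s < -1) :
    Summable fun j : ℕ => ((j : ℝ) + 1) ^ s := by
  simpa using (summable_nat_add_iff 1).2 (Real.summable_nat_rpow.2 hs)

lemma sum_nat_add_one_rpow_le {s : ℝ} (hs : 1 < s) {K : ℕ} {F : Finset ℕ}
    (hF : ∀ j ∈ F, K ≤ j) :
    ∑ j ∈ F, ((j : ℝ) + 1) ^ (-s) ≤ s / (s - 1) * ((K : ℝ) + 1) ^ (1 - s) := by
  have hs' : 0 < s - 1 := by linarith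
  obtain ⟨n, hKn, hFn⟩ : ∃ n, K + 1 ≤ n ∧ F ⊆ Finset.Ico K n := by
    obtain ⟨n, hn⟩ := F.exists_nat_subset_range
    exact ⟨max (K + 1) n, le_max_left _ _, fun j hj => Finset.mem_Ico.2
      ⟨hF j hj, (Finset.mem_range.1 (hn hj)).trans_le (le_max_right _ _)⟩⟩
  have hfirst : ((K : ℝ) + 1) ^ (-s) ≤ ((K : ℝ) + 1) ^ (1 - s) :=
    Real.rpow_le_rpow_of_exponent_le (by linarith [K.cast_nonneg (α := ℝ)]) (by linarith)
  have hint : ∑ j ∈ Finset.Ico (K + 1) n, ((j : ℝ) + 1) ^ (-s) ≤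
      (s - 1)⁻¹ * ((K : ℝ) + 1) ^ (1 - s) := by
    have hanti : AntitoneOn (fun x : ℝ => x ^ (-s)) (Set.Icc ((K + 1 : ℕ) : ℝ) n) :=
      fun x hx y _ hxy => Real.rpow_le_rpow_of_nonpos
        ((Nat.cast_pos.2 K.succ_pos).trans_le hx.1) hxy (by linarith)
    have h0 : (0 : ℝ) ∉ Set.uIcc ((K + 1 : ℕ) : ℝ) n := by
      rw [Set.uIcc_of_le (by exact_mod_cast hKn)]
      exact fun h => absurd h.1 (not_le.2 (Nat.cast_pos.2 K.succ_pos))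
    calc ∑ j ∈ Finset.Ico (K + 1) n, ((j : ℝ) + 1) ^ (-s)
        ≤ ∫ x in ((K + 1 : ℕ) : ℝ)..n, x ^ (-s) := by
          simpa using hanti.sum_le_integral_Ico hKn
      _ = (s - 1)⁻¹ * (((K : ℝ) + 1) ^ (1 - s) - (n : ℝ) ^ (1 - s)) := by
          rw [integral_rpow (Or.inr ⟨by linarith, h0⟩), ← neg_div_neg_eq,
            show -(-s + 1) = s - 1 by ring, show -s + 1 = 1 - s by ring]
          push_cast
          ring
      _ ≤ (s - 1)⁻¹ * ((K : ℝ) + 1) ^ (1 - s) :=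
          mul_le_mul_of_nonneg_left (sub_le_self _ (by positivity)) (inv_nonneg.2 hs'.le)
  calc ∑ j ∈ F, ((j : ℝ) + 1) ^ (-s) ≤ ∑ j ∈ Finset.Ico K n, ((j : ℝ) + 1) ^ (-s) :=
        Finset.sum_le_sum_of_subset_of_nonneg hFn fun j _ _ => by positivity
    _ ≤ ((K : ℝ) + 1) ^ (1 - s) + (s - 1)⁻¹ * ((K : ℝ) + 1) ^ (1 - s) := by
        rw [Finset.sum_eq_sum_Ico_succ_bot (Nat.lt_of_succ_le hKn)]
        exact add_le_add hfirst hint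
    _ = s / (s - 1) * ((K : ℝ) + 1) ^ (1 - s) := by
        field_simp
        ring

end PolynomialDecay

section TruncationBias

variable {H : Type*} [NormedAddCommGroup H] [InnerProductSpace ℝ H]
  (A : H →L[ℝ] H) (h : HilbertBasis ℕ ℝ H) {c γ ς : ℝ}

lemma norm_apply_sq_le_of_inner_le (hγ : 1 / 2 < γ) {v : H} {b : ℝ}
    (hv : ∀ j : ℕ, |⟪h j, v⟫| ≤ b * ((j : ℝ) + 1) ^ (-γ)) :
    ‖v‖ ^ 2 ≤ b ^ 2 * ∑' j : ℕ, ((j : ℝ) + 1) ^ (-(2 * γ)) := by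
  have hsum : Summable fun j : ℕ => ((j : ℝ) + 1) ^ (-(2 * γ)) :=
    summable_nat_add_one_rpow (by linarith)
  refine hasSum_le (fun j => ?_) (hasSum_sq_inner h v) (hsum.hasSum.mul_left (b ^ 2))
  calc ⟪h j, v⟫ ^ 2 ≤ (b * ((j : ℝ) + 1) ^ (-γ)) ^ 2 :=
        sq_le_sq' (neg_le_of_abs_le (hv j)) (le_of_abs_le (hv j))
    _ = b ^ 2 * ((j : ℝ) + 1) ^ (-(2 * γ)) := by
        rw [mul_pow, ← Real.rpow_mul_natCast (by positivity)]
        push_cast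
        ring_nf

variable [CompleteSpace H]

lemma exists_norm_comp_compl_firstProj_sq_le (hγ : 1 / 2 < γ) (hς : 1 / 2 < ς)
    (hA : ∀ j l : ℕ, |⟪h j, A (h l)⟫| ≤ c * ((j : ℝ) + 1) ^ (-γ) * ((l : ℝ) + 1) ^ (-ς)) :
    ∃ C : ℝ, 0 ≤ C ∧ ∀ K : ℕ, ‖A ∘L (ContinuousLinearMap.id ℝ H - firstProj h K)‖ ^ 2 ≤
      C * ((K : ℝ) + 1) ^ (1 - 2 * ς) := by
  set G := ∑' j : ℕ, ((j : ℝ) + 1) ^ (-(2 * γ))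
  have : 0 ≤ G := tsum_nonneg fun j => by positivity
  have hcol : ∀ l : ℕ, ‖A (h l)‖ ^ 2 ≤ c ^ 2 * G * ((l : ℝ) + 1) ^ (-(2 * ς)) := fun l => by
    calc ‖A (h l)‖ ^ 2 ≤ (c * ((l : ℝ) + 1) ^ (-ς)) ^ 2 * G :=
          norm_apply_sq_le_of_inner_le h hγ fun j => (hA j l).trans_eq (by ring)
      _ = c ^ 2 * G * ((l : ℝ) + 1) ^ (-(2 * ς)) := by
          rw [mul_pow, ← Real.rpow_mul_natCast (by positivity)]
          push_cast
          ring_nf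
  have hs : 0 < 2 * ς - 1 := by linarith
  refine ⟨c ^ 2 * G * (2 * ς / (2 * ς - 1)), by positivity, fun K => ?_⟩
  refine norm_sq_le_of_sum_norm_sq_le _ h fun F => ?_
  calc ∑ l ∈ F, ‖(A ∘L (ContinuousLinearMap.id ℝ H - firstProj h K)) (h l)‖ ^ 2
      = ∑ l ∈ F with K ≤ l, ‖A (h l)‖ ^ 2 := by
        rw [Finset.sum_filter]
        refine Finset.sum_congr rfl fun l _ => ?_
        rw [ContinuousLinearMap.comp_apply, isDiag_compl_firstProj h K l]
        by_cases hl : l < K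
        · simp [hl]
        · simp [hl, not_lt.1 hl]
    _ ≤ c ^ 2 * G * ∑ l ∈ F with K ≤ l, ((l : ℝ) + 1) ^ (-(2 * ς)) := by
        rw [Finset.mul_sum]
        exact Finset.sum_le_sum fun l _ => hcol l
    _ ≤ c ^ 2 * G * (2 * ς / (2 * ς - 1)) * ((K : ℝ) + 1) ^ (1 - 2 * ς) := by
        rw [mul_assoc (c ^ 2 * G) (_ / _)]
        exact mul_le_mul_of_nonneg_left (sum_nat_add_one_rpow_le (s := 2 * ς) (by linarith)
          fun l hl => (Finset.mem_filter.1 hl).2) (by positivity)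

lemma exists_norm_comp_compl_truncCount_sq_le {ν : ℕ → ℝ} {k ρ : ℝ} (hν : Antitone ν)
    (hν0 : Tendsto ν atTop (𝓝 0)) (hk : 0 < k) (hρ : 0 < ρ)
    (hgap : ∀ j : ℕ, k * ((j : ℝ) + 1) ^ (-ρ - 1) ≤ ν j ^ 2 - ν (j + 1) ^ 2)
    (hγ : 1 / 2 < γ) (hς : 1 / 2 < ς)
    (hA : ∀ j l : ℕ, |⟪h j, A (h l)⟫| ≤ c * ((j : ℝ) + 1) ^ (-γ) * ((l : ℝ) + 1) ^ (-ς)) :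
    ∃ C : ℝ, 0 ≤ C ∧ ∀ α : ℝ, 0 < α →
      ‖A ∘L (ContinuousLinearMap.id ℝ H - firstProj h (truncCount ν α))‖ ^ 2 ≤
        C * α ^ ((2 * ς - 1) / ρ) := by
  obtain ⟨C, hC0, hC⟩ := exists_norm_comp_compl_firstProj_sq_le A h hγ hς hA
  set b := k * 2 ^ (-ρ - 1)
  have hb : 0 < b := by positivity
  refine ⟨C * b⁻¹ ^ ((2 * ς - 1) / ρ), by positivity, fun α hα => (hC _).trans ?_⟩
  set K := truncCount ν α
  have hK : (0 : ℝ) < (K : ℝ) + 1 := by positivity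
  have hbα : b * ((K : ℝ) + 1) ^ (-ρ) ≤ α :=
    (le_of_rpow_le_sub_succ hk.le (by linarith) (fun j => sq_nonneg (ν j)) hgap K).trans
      (not_lt.1 (mt (lt_truncCount_iff hν hν0 hα K).2 (lt_irrefl K)))
  rw [mul_assoc, ← Real.mul_rpow (inv_nonneg.2 hb.le) hα.le]
  refine mul_le_mul_of_nonneg_left ?_ hC0
  calc ((K : ℝ) + 1) ^ (1 - 2 * ς) = (((K : ℝ) + 1) ^ (-ρ)) ^ ((2 * ς - 1) / ρ) := by
        rw [← Real.rpow_mul hK.le]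
        congr 1
        field_simp
        ring
    _ ≤ (b⁻¹ * α) ^ ((2 * ς - 1) / ρ) := by
        refine Real.rpow_le_rpow (by positivity) ?_ (div_nonneg (by linarith) hρ.le)
        rwa [inv_mul_eq_div, le_div_iff₀ hb, mul_comm]

end TruncationBias

section Estimator

variable {H : Type*} [NormedAddCommGroup H] [InnerProductSpace ℝ H] [CompleteSpace H]
  {g h : HilbertBasis ℕ ℝ H} {μ ν : ℕ → ℝ}

lemma norm_stochastic_error_sq_le (U X : H →L[ℝ] H) {K₁ K₂ : ℕ} {t₁ t₂ : ℝ}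
    (hQ : IsEigensystem (X† ∘L regInv μ g K₁ ∘L X) ν h) (ht₁ : 0 < t₁) (ht₂ : 0 < t₂)
    (hμ : ∀ j < K₁, t₁ ≤ μ j) (hν : ∀ j < K₂, t₂ ≤ ν j) :
    ‖U† ∘L regInv μ g K₁ ∘L X ∘L regInv ν h K₂‖ ^ 2 ≤ ‖U‖ ^ 2 * (t₁⁻¹ * t₂⁻¹) := by
  set R₁ := regInv μ g K₁
  set R₂ := regInv ν h K₂
  have hW : ‖R₁ ∘L X ∘L R₂‖ ≤ √(t₁⁻¹ * t₂⁻¹) := by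
    refine (R₁ ∘L X ∘L R₂).opNorm_le_bound (Real.sqrt_nonneg _) fun v => ?_
    refine le_of_sq_le_sq ?_ (by positivity)
    have hproj : (X†) (R₁ (X (R₂ v))) = firstProj h K₂ v :=
      DFunLike.congr_fun (hQ.comp_regInv fun j hj => (ht₂.trans_le (hν j hj)).ne') v
    calc ‖R₁ (X (R₂ v))‖ ^ 2 ≤ t₁⁻¹ * ⟪X (R₂ v), R₁ (X (R₂ v))⟫ :=
          norm_regInv_apply_sq_le g ht₁ hμ _
      _ = t₁⁻¹ * ⟪R₂ v, firstProj h K₂ v⟫ := by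
          rw [← ContinuousLinearMap.adjoint_inner_right, hproj]
      _ ≤ t₁⁻¹ * ((t₂⁻¹ * ‖v‖) * (1 * ‖v‖)) := by
          gcongr
          exact (real_inner_le_norm _ _).trans (mul_le_mul
            (R₂.le_of_opNorm_le (norm_regInv_le h ht₂ hν) v)
            ((firstProj h K₂).le_of_opNorm_le (norm_firstProj_le_one h K₂) v)
            (norm_nonneg _) (by positivity))
      _ = (√(t₁⁻¹ * t₂⁻¹) * ‖v‖) ^ 2 := by
          rw [mul_pow, Real.sq_sqrt (by positivity)]
          ring
  calc ‖U† ∘L R₁ ∘L X ∘L R₂‖ ^ 2 ≤ (‖U‖ * √(t₁⁻¹ * t₂⁻¹)) ^ 2 := by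
        gcongr
        exact ((U†).opNorm_comp_le _).trans (by rw [norm_adjoint_eq]; gcongr)
    _ = ‖U‖ ^ 2 * (t₁⁻¹ * t₂⁻¹) := by rw [mul_pow, Real.sq_sqrt (by positivity)]

lemma norm_first_stage_sub_le (B C V : H →L[ℝ] H) {D : H →L[ℝ] H} {K : ℕ} {t : ℝ}
    (hD : IsEigensystem D μ g) (ht : 0 < t) (hμ : ∀ j < K, t ≤ μ j)
    (hμ' : ∀ j, K ≤ j → |μ j| ≤ t) :
    ‖(D ∘L B† + V)† ∘L regInv μ g K ∘L (D ∘L B† + V) - B ∘L C ∘L B†‖ ≤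
      ‖B‖ ^ 2 * (‖D - C‖ + t) + 2 * ‖B‖ * ‖V‖ + ‖V‖ ^ 2 * t⁻¹ := by
  set R := regInv μ g K
  set I := firstProj g K
  have hμ0 : ∀ j < K, μ j ≠ 0 := fun j hj => (ht.trans_le (hμ j hj)).ne'
  have hDR : ∀ v, D (R v) = I v := DFunLike.congr_fun (hD.comp_regInv hμ0)
  have hRD : ∀ v, R (D v) = I v := DFunLike.congr_fun (hD.regInv_comp hμ0)
  have hsplit : (D ∘L B† + V)† ∘L R ∘L (D ∘L B† + V) - B ∘L C ∘L B† =
      B ∘L (D - C) ∘L B† - B ∘L (D ∘L (ContinuousLinearMap.id ℝ H - I)) ∘L B† +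
        B ∘L I ∘L V + V† ∘L I ∘L B† + V† ∘L R ∘L V := by
    have hadj : (D ∘L B† + V)† = B ∘L D + V† := by
      rw [map_add, ContinuousLinearMap.adjoint_comp, ContinuousLinearMap.adjoint_adjoint,
        hD.isDiag.adjoint_eq]
    ext v
    simp only [hadj, sub_apply, add_apply,
      ContinuousLinearMap.comp_apply, ContinuousLinearMap.id_apply, map_add, map_sub, hDR, hRD]
    abel
  have hB : ‖B†‖ ≤ ‖B‖ := (norm_adjoint_eq B).le
  have hV : ‖V†‖ ≤ ‖V‖ := (norm_adjoint_eq V).le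
  have hI : ‖I‖ ≤ 1 := norm_firstProj_le_one g K
  have hR : ‖R‖ ≤ t⁻¹ := norm_regInv_le g ht hμ
  have hDI : ‖D ∘L (ContinuousLinearMap.id ℝ H - I)‖ ≤ t :=
    hD.norm_comp_compl_firstProj_le ht.le hμ'
  calc _ ≤ ‖B ∘L (D - C) ∘L B†‖ + ‖B ∘L (D ∘L (ContinuousLinearMap.id ℝ H - I)) ∘L B†‖ +
          ‖B ∘L I ∘L V‖ + ‖V† ∘L I ∘L B†‖ + ‖V† ∘L R ∘L V‖ := by
        rw [hsplit]
        exact norm_add_le_of_le (norm_add_le_of_le (norm_add_le_of_le (norm_sub_le _ _) le_rfl)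
          le_rfl) le_rfl
    _ ≤ ‖B‖ * (‖D - C‖ * ‖B‖) + ‖B‖ * (t * ‖B‖) + ‖B‖ * (1 * ‖V‖) + ‖V‖ * (1 * ‖B‖) +
          ‖V‖ * (t⁻¹ * ‖V‖) := by
        gcongr <;> exact (norm_comp_comp_le _ _ _).trans (by gcongr)
    _ = _ := by ring

end Estimator

section Moments

variable {H : Type*} [NormedAddCommGroup H] [InnerProductSpace ℝ H] {Ω : Type*}

lemma tens_eq_rankOne (a b : H) : tens a b = InnerProductSpace.rankOne ℝ b a := rfl

lemma comp_tens_comp_adjoint [CompleteSpace H] (S : H →L[ℝ] H) (a b : H) :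
    S ∘L tens a b ∘L S† = tens (S a) (S b) := by
  ext v
  simp [ContinuousLinearMap.adjoint_inner_right]

lemma IsDiag.hasSum [CompleteSpace H] {ι : Type*} {e : HilbertBasis ι ℝ H} {d : ι → ℝ}
    {S : H →L[ℝ] H} (hS : IsDiag e d S) (hd : Summable d) :
    HasSum (fun j => d j • tens (e j) (e j)) S := by
  classical
  have hsum : Summable fun j => d j • tens (e j) (e j) :=
    Summable.of_norm_bounded hd.abs fun j => by
      simp [norm_smul, tens_eq_rankOne, e.orthonormal.1]
  have hdiag : IsDiag e d (∑' j, d j • tens (e j) (e j)) := fun i => by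
    refine (hsum.hasSum.mapL (ContinuousLinearMap.apply ℝ H (e i))).unique ?_
    convert hasSum_single i fun j hj => ?_ using 1
    · simp [e.orthonormal.1]
    · simp [e.orthonormal.2 hj]
  exact hdiag.ext hS (fun _ => rfl) ▸ hsum.hasSum

lemma sampleOp_apply (a b : ℕ → Ω → H) (T : ℕ) (ω : Ω) (v : H) :
    sampleOp a b T ω v = (T : ℝ)⁻¹ • ∑ t ∈ Finset.range T, ⟪a t ω, v⟫ • b t ω := by
  simp [sampleOp]

lemma tendsto_sampleOp_basis (a b : ℕ → Ω → H) (T : ℕ) (ω : Ω) (e : HilbertBasis ℕ ℝ H) :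
    Tendsto (fun j => sampleOp a b T ω (e j)) atTop (𝓝 0) := by
  have hcoord : ∀ v : H, Tendsto (fun j => ⟪v, e j⟫) atTop (𝓝 0) := fun v => by
    refine (tendsto_zero_iff_abs_tendsto_zero _).2 ?_
    simpa only [real_inner_comm, Real.sqrt_sq_eq_abs, Real.sqrt_zero, Function.comp_def] using
      (hasSum_sq_inner e v).summable.tendsto_atTop_zero.sqrt
  simp only [sampleOp_apply]
  simpa using (tendsto_finsetSum (Finset.range T) fun t _ =>
    (hcoord (a t ω)).smul_const (b t ω)).const_smul (T : ℝ)⁻¹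

lemma sampleOp_eq_comp_adjoint_add [CompleteSpace H] (S : H →L[ℝ] H) (a b z : ℕ → Ω → H) (T : ℕ)
    (ω : Ω) : sampleOp b z T ω = sampleOp a z T ω ∘L S† + sampleOp (resid S a b) z T ω := by
  ext v
  simp [sampleOp_apply, resid, inner_sub_left, sub_smul, smul_sub,
    ContinuousLinearMap.adjoint_inner_right]

variable [MeasurableSpace Ω] {P : Measure Ω} {a b c : Ω → H}

lemma integrable_tens (ha : MemLp a 2 P) (hb : MemLp b 2 P) :
    Integrable (fun ω => tens (a ω) (b ω)) P := by
  refine (ha.norm.integrable_mul hb.norm).mono' ?_ (.of_forall fun ω => ?_)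
  · have htens : Continuous fun p : H × H => InnerProductSpace.rankOne ℝ p.2 p.1 :=
      ((InnerProductSpace.rankOne ℝ).continuous.comp continuous_snd).clm_apply continuous_fst
    exact htens.comp_aestronglyMeasurable (ha.1.prodMk hb.1)
  · rw [tens_eq_rankOne, InnerProductSpace.norm_rankOne, mul_comm, Pi.mul_apply]

lemma momentOp_sub_right (ha : MemLp a 2 P) (hb : MemLp b 2 P) (hc : MemLp c 2 P) :
    momentOp P a (fun ω => b ω - c ω) = momentOp P a b - momentOp P a c := by
  rw [momentOp, momentOp, momentOp, ← integral_sub (integrable_tens ha hb) (integrable_tens ha hc)]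
  congr 1 with ω v
  simp [smul_sub]

variable [CompleteSpace H]

lemma momentOp_comp_right (S : H →L[ℝ] H) (ha : MemLp a 2 P) (hb : MemLp b 2 P) :
    momentOp P a (fun ω => S (b ω)) = S ∘L momentOp P a b := by
  rw [momentOp, momentOp, ← ContinuousLinearMap.compL_apply (𝕜 := ℝ),
    ← ContinuousLinearMap.integral_comp_comm _ (integrable_tens ha hb)]
  congr 1 with ω v
  simp

lemma inner_momentOp (ha : MemLp a 2 P) (hb : MemLp b 2 P) (v w : H) :
    ⟪w, momentOp P a b v⟫ = ∫ ω, ⟪a ω, v⟫ * ⟪b ω, w⟫ ∂P := by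
  rw [momentOp, ContinuousLinearMap.integral_apply (integrable_tens ha hb),
    ← integral_inner ((integrable_tens ha hb).apply_continuousLinearMap v)]
  simp [real_inner_smul_right, real_inner_comm]

lemma momentOp_adjoint (ha : MemLp a 2 P) (hb : MemLp b 2 P) :
    (momentOp P a b)† = momentOp P b a := by
  refine ContinuousLinearMap.ext fun v => ext_inner_right ℝ fun w => ?_
  rw [ContinuousLinearMap.adjoint_inner_left, inner_momentOp ha hb, real_inner_comm,
    inner_momentOp hb ha]
  simp only [mul_comm]

lemma momentOp_comp_comp (S : H →L[ℝ] H) (ha : MemLp a 2 P) (hb : MemLp b 2 P) :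
    momentOp P (fun ω => S (a ω)) (fun ω => S (b ω)) = S ∘L momentOp P a b ∘L S† := by
  have hSa : MemLp (fun ω => S (a ω)) 2 P := S.comp_memLp' ha
  rw [momentOp_comp_right S hSa hb, ← momentOp_adjoint hb hSa, momentOp_comp_right S hb ha,
    ContinuousLinearMap.adjoint_comp, momentOp_adjoint hb ha]

lemma summable_of_isDiag_momentOp {ι : Type*} {e : HilbertBasis ι ℝ H} {d : ι → ℝ}
    (ha : MemLp a 2 P) (hd : IsDiag e d (momentOp P a a)) : Summable d := by
  have hsq : ∀ j, Integrable (fun ω => ⟪a ω, e j⟫ ^ 2) P := fun j =>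
    (ha.inner_const (e j)).integrable_sq
  have hdj : ∀ j, d j = ∫ ω, ⟪a ω, e j⟫ ^ 2 ∂P := fun j => by
    calc d j = ⟪e j, momentOp P a a (e j)⟫ := by
          rw [hd j, real_inner_smul_right, real_inner_self_eq_norm_sq, e.orthonormal.1]; simp
      _ = ∫ ω, ⟪a ω, e j⟫ ^ 2 ∂P := by simp only [inner_momentOp ha ha, sq]
  refine summable_of_sum_le (c := ∫ ω, ‖a ω‖ ^ 2 ∂P) (fun j => ?_) fun F => ?_
  · rw [Pi.zero_apply, hdj]
    exact integral_nonneg fun ω => sq_nonneg _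
  · simp only [hdj]
    rw [← integral_finsetSum F fun j _ => hsq j]
    refine integral_mono (integrable_finsetSum F fun j _ => hsq j) ha.norm.integrable_sq fun ω => ?_
    simpa only [real_inner_comm] using
      sum_le_hasSum F (fun j _ => sq_nonneg _) (hasSum_sq_inner e (a ω))

lemma popQ_eq {C Cxz B : H →L[ℝ] H} {μ : ℕ → ℝ} {g : HilbertBasis ℕ ℝ H} (hC : IsDiag g μ C)
    (hμ : ∀ j, μ j ≠ 0) (hs : Summable μ) (hB : Cxz† = B ∘L C) :
    popQ Cxz μ g = B ∘L C ∘L B† := by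
  have hterm : ∀ j, (μ j)⁻¹ • tens ((Cxz†) (g j)) ((Cxz†) (g j)) =
      B ∘L (μ j • tens (g j) (g j)) ∘L B† := fun j => by
    rw [hB, ContinuousLinearMap.smul_comp, ContinuousLinearMap.comp_smul, comp_tens_comp_adjoint]
    ext v
    have := hμ j
    simp only [ContinuousLinearMap.comp_apply, hC j, map_smul, smul_apply, tens_apply,
      real_inner_smul_left, smul_smul]
    field_simp
  simp only [popQ, hterm]
  exact (((hC.hasSum hs).mapL ((ContinuousLinearMap.compL ℝ H H H).flip (B†))).mapL
    (ContinuousLinearMap.compL ℝ H H H B)).tsum_eq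

lemma popQ_momentOp_eq {x z : Ω → H} {B : H →L[ℝ] H} {μ : ℕ → ℝ} {g : HilbertBasis ℕ ℝ H}
    (hx : MemLp x 2 P) (hz : MemLp z 2 P) (hv : momentOp P z (fun ω => x ω - B (z ω)) = 0)
    (hzz : IsDiag g μ (momentOp P z z)) (hμ : ∀ j, μ j ≠ 0) :
    popQ (momentOp P x z) μ g = B ∘L momentOp P z z ∘L B† := by
  refine popQ_eq hzz hμ (summable_of_isDiag_momentOp hz hzz) ?_
  rw [momentOp_adjoint hx hz, ← momentOp_comp_right B hz hz, ← sub_eq_zero,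
    ← momentOp_sub_right (c := fun ω => B (z ω)) hz hx (B.comp_memLp' hz), hv]

lemma tendsto_eigenvalues_popQ {x z : Ω → H} {B : H →L[ℝ] H} {μ ν : ℕ → ℝ}
    {g h : HilbertBasis ℕ ℝ H} (hx : MemLp x 2 P) (hz : MemLp z 2 P)
    (hv : momentOp P z (fun ω => x ω - B (z ω)) = 0) (hzz : IsDiag g μ (momentOp P z z))
    (hμ : ∀ j, μ j ≠ 0) (hQ : IsDiag h ν (popQ (momentOp P x z) μ g)) :
    Tendsto ν atTop (𝓝 0) := by
  rw [popQ_momentOp_eq hx hz hv hzz hμ, ← momentOp_comp_comp B hz hz] at hQ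
  exact (summable_of_isDiag_momentOp (B.comp_memLp' hz) hQ).tendsto_atTop_zero

end Moments

lemma momentOp_eq_zero_of_condExp_eq_zero {H : Type*} [NormedAddCommGroup H]
    [InnerProductSpace ℝ H] [CompleteSpace H] {Ω : Type*} {m m0 : MeasurableSpace Ω}
    {P : Measure[m0] Ω} [IsFiniteMeasure P] {u z : Ω → H} (hm : m ≤ m0) (hu : MemLp u 2 P)
    (hz : MemLp z 2 P) (hzm : StronglyMeasurable[m] z) (hc : P[u | m] =ᵐ[P] 0) :
    momentOp P u z = 0 := by
  ext v
  have huz := (integrable_tens hu hz).apply_continuousLinearMap v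
  have hpull := condExp_bilin_of_stronglyMeasurable_right (m := m)
    (ContinuousLinearMap.lsmul ℝ ℝ ∘L innerSL ℝ v) hzm
    (by simpa [real_inner_comm] using huz) (hu.integrable one_le_two)
  rw [momentOp, ContinuousLinearMap.integral_apply (integrable_tens hu hz), zero_apply,
    ← integral_condExp hm]
  refine integral_eq_zero_of_ae ?_
  filter_upwards [hpull, hc] with ω hω hcω
  simpa [hcω, real_inner_comm] using hω

section StochasticOrder

variable {Ω : Type*} [MeasurableSpace Ω] {P : Measure Ω} {E : Type*} [NormedAddCommGroup E]

lemma enorm_le_ofReal_iff {a : E} {b : ℝ} (hb : 0 ≤ b) :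
    ‖a‖ₑ ≤ ENNReal.ofReal b ↔ ‖a‖ ≤ b := by
  rw [← ofReal_norm, ENNReal.ofReal_le_ofReal_iff hb]

lemma enorm_sq_le_ofReal_iff {a : E} {b : ℝ} (hb : 0 ≤ b) :
    ‖a‖ₑ ^ 2 ≤ ENNReal.ofReal b ↔ ‖a‖ ^ 2 ≤ b := by
  rw [← ofReal_norm, ← ENNReal.ofReal_pow (norm_nonneg a), ENNReal.ofReal_le_ofReal_iff hb]

lemma IsBigOp.imp₂ {X₁ X₂ Y : ℕ → Ω → ℝ≥0∞} {r₁ r₂ r : ℕ → ℝ} (h₁ : IsBigOp P X₁ r₁)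
    (h₂ : IsBigOp P X₂ r₂) (hr₁ : ∀ T, 0 ≤ r₁ T) (hr₂ : ∀ T, 0 ≤ r₂ T)
    (h : ∀ M : ℝ, 0 ≤ M → ∃ M' : ℝ, ∀ᶠ T in atTop, ∀ ω,
      X₁ T ω ≤ ENNReal.ofReal (M * r₁ T) → X₂ T ω ≤ ENNReal.ofReal (M * r₂ T) →
      Y T ω ≤ ENNReal.ofReal (M' * r T)) : IsBigOp P Y r := by
  intro ε hε
  obtain ⟨M₁, hM₁⟩ := h₁ (ε / 2) (half_pos hε)
  obtain ⟨M₂, hM₂⟩ := h₂ (ε / 2) (half_pos hε)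
  set M := max 0 (max M₁ M₂)
  have hM₁M : M₁ ≤ M := (le_max_left _ _).trans (le_max_right _ _)
  have hM₂M : M₂ ≤ M := (le_max_right _ _).trans (le_max_right _ _)
  obtain ⟨M', hM'⟩ := h M (le_max_left _ _)
  refine ⟨M', ?_⟩
  filter_upwards [hM₁, hM₂, hM'] with T hT₁ hT₂ hT
  have hsub : {ω | ENNReal.ofReal (M' * r T) < Y T ω} ⊆
      {ω | ENNReal.ofReal (M₁ * r₁ T) < X₁ T ω} ∪ {ω | ENNReal.ofReal (M₂ * r₂ T) < X₂ T ω} := by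
    intro ω hω
    by_contra! hc
    simp only [Set.mem_union, Set.mem_ofPred_eq, not_or, not_lt] at hc
    exact hω.not_ge (hT ω
      (hc.1.trans (ENNReal.ofReal_le_ofReal (mul_le_mul_of_nonneg_right hM₁M (hr₁ T))))
      (hc.2.trans (ENNReal.ofReal_le_ofReal (mul_le_mul_of_nonneg_right hM₂M (hr₂ T)))))
  calc P {ω | ENNReal.ofReal (M' * r T) < Y T ω}
      ≤ P {ω | ENNReal.ofReal (M₁ * r₁ T) < X₁ T ω} +
          P {ω | ENNReal.ofReal (M₂ * r₂ T) < X₂ T ω} :=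
        (measure_mono hsub).trans (measure_union_le _ _)
    _ ≤ ENNReal.ofReal (ε / 2) + ENNReal.ofReal (ε / 2) := add_le_add hT₁ hT₂
    _ = ENNReal.ofReal ε := by
        rw [← ENNReal.ofReal_add (half_pos hε).le (half_pos hε).le, add_halves]

lemma IsBigOp.imp {X Y : ℕ → Ω → ℝ≥0∞} {r r' : ℕ → ℝ} (h : IsBigOp P X r) (hr : ∀ T, 0 ≤ r T)
    (hXY : ∀ M : ℝ, 0 ≤ M → ∃ M' : ℝ, ∀ᶠ T in atTop, ∀ ω,
      X T ω ≤ ENNReal.ofReal (M * r T) → Y T ω ≤ ENNReal.ofReal (M' * r' T)) :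
    IsBigOp P Y r' :=
  h.imp₂ h hr hr fun M hM => (hXY M hM).imp fun _ hM' => hM'.mono fun _ hT ω hω _ => hT ω hω

lemma IsBigOp.mono {X Y : ℕ → Ω → ℝ≥0∞} {r : ℕ → ℝ} (h : IsBigOp P X r)
    (hYX : ∀ T ω, Y T ω ≤ X T ω) : IsBigOp P Y r := fun ε hε =>
  (h ε hε).imp fun _ hM => hM.mono fun T hT =>
    (measure_mono fun ω hω => hω.trans_le (hYX T ω)).trans hT

lemma IsBigOp.mono_rate {X : ℕ → Ω → ℝ≥0∞} {r r' : ℕ → ℝ} (h : IsBigOp P X r)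
    (hr : ∀ T, 0 ≤ r T) (hrr' : ∀ T, r T ≤ r' T) : IsBigOp P X r' :=
  h.imp hr fun M hM => ⟨M, .of_forall fun T _ hω =>
    hω.trans (ENNReal.ofReal_le_ofReal (mul_le_mul_of_nonneg_left (hrr' T) hM))⟩

lemma IsBigOp.trans_isBigO {X : ℕ → Ω → ℝ≥0∞} {r r' : ℕ → ℝ} (h : IsBigOp P X r)
    (hr : ∀ T, 0 ≤ r T) (hr' : ∀ T, 0 ≤ r' T) (hrr' : r =O[atTop] r') : IsBigOp P X r' := by
  obtain ⟨K, hK⟩ := hrr'.bound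
  refine h.imp hr fun M hM => ⟨M * K, hK.mono fun T hT ω hω => hω.trans ?_⟩
  rw [Real.norm_of_nonneg (hr T), Real.norm_of_nonneg (hr' T)] at hT
  rw [mul_assoc]
  exact ENNReal.ofReal_le_ofReal (mul_le_mul_of_nonneg_left hT hM)

lemma IsBigOp.sub_sq {F G : ℕ → Ω → E} {r s : ℕ → ℝ} (hF : IsBigOp P (fun T ω => ‖F T ω‖ₑ ^ 2) r)
    (hG : IsBigOp P (fun T ω => ‖G T ω‖ₑ ^ 2) s) (hr : ∀ T, 0 ≤ r T) (hs : ∀ T, 0 ≤ s T) :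
    IsBigOp P (fun T ω => ‖F T ω - G T ω‖ₑ ^ 2) (fun T => r T + s T) := by
  refine hF.imp₂ hG hr hs fun M hM => ⟨2 * M, .of_forall fun T ω hω₁ hω₂ => ?_⟩
  have hMr := mul_nonneg hM (hr T)
  have hMs := mul_nonneg hM (hs T)
  rw [enorm_sq_le_ofReal_iff hMr] at hω₁
  rw [enorm_sq_le_ofReal_iff hMs] at hω₂
  rw [enorm_sq_le_ofReal_iff (by linarith)]
  calc ‖F T ω - G T ω‖ ^ 2 ≤ (‖F T ω‖ + ‖G T ω‖) ^ 2 := by gcongr; exact norm_sub_le _ _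
    _ ≤ 2 * (‖F T ω‖ ^ 2 + ‖G T ω‖ ^ 2) := add_sq_le
    _ ≤ 2 * M * (r T + s T) := by linarith

lemma IsBigOp.tendstoInMeasure {F : ℕ → Ω → E} {f : Ω → E} {r : ℕ → ℝ}
    (h : IsBigOp P (fun T ω => ‖F T ω - f ω‖ₑ ^ 2) r) (hr : Tendsto r atTop (𝓝 0)) :
    TendstoInMeasure P F atTop f := by
  rw [tendstoInMeasure_iff_norm]
  refine fun ε hε => ENNReal.tendsto_nhds_zero.2 fun η hη => ?_
  obtain ⟨δ, -, hδη⟩ := ENNReal.lt_iff_exists_real_btwn.1 hη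
  obtain ⟨M, hM⟩ := h δ (ENNReal.ofReal_pos.1 hδη.1)
  have hMr : Tendsto (fun T => M * r T) atTop (𝓝 0) := by simpa using hr.const_mul M
  filter_upwards [hM, hMr.eventually_lt_const (pow_pos hε 2)] with T hT hlt
  refine (measure_mono fun ω hω => ?_).trans (hT.trans hδη.2.le)
  have hεω : ε ^ 2 ≤ ‖F T ω - f ω‖ ^ 2 := pow_le_pow_left₀ hε.le hω 2
  rw [Set.mem_ofPred_eq, ← ofReal_norm, ← ENNReal.ofReal_pow (norm_nonneg _)]
  exact (ENNReal.ofReal_lt_ofReal_iff ((pow_pos hε 2).trans_le hεω)).2 (hlt.trans_le hεω)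

end StochasticOrder

section Rates

variable {ι : Type*} {l : Filter ι}

lemma inv_isLittleO_of_inv_isLittleO_rpow {f k : ι → ℝ} {a : ℝ} (ha : a ≤ 1)
    (hk : Tendsto k l atTop) (hf : ∀ i, 0 < f i) (h : (fun i => (f i)⁻¹) =o[l] fun i => k i ^ a) :
    (fun i => (k i)⁻¹) =o[l] f := by
  have hpow : (fun i => k i ^ a) =O[l] k := .of_bound 1 <| by
    filter_upwards [hk.eventually_ge_atTop 1] with i hi
    have := Real.rpow_le_rpow_of_exponent_le hi ha
    rw [Real.rpow_one] at this
    rw [one_mul, Real.norm_of_nonneg (by positivity), Real.norm_of_nonneg (by positivity)]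
    exact this
  simpa only [inv_inv] using (h.trans_isBigO hpow).inv_rev
    (.of_forall fun i hi => absurd hi (inv_pos.2 (hf i)).ne')

lemma isLittleO_of_inv_isLittleO_rpow_neg {f k : ι → ℝ} {a : ℝ} (ha : a ≤ 1)
    (hk : Tendsto k l (𝓝 0)) (hk0 : ∀ i, 0 < k i) (hf : ∀ i, 0 < f i)
    (h : (fun i => (f i)⁻¹) =o[l] fun i => k i ^ (-a)) : k =o[l] f := by
  have hk_inv : Tendsto (fun i => (k i)⁻¹) l atTop :=
    (tendsto_nhdsWithin_iff.2 ⟨hk, .of_forall hk0⟩).inv_tendsto_nhdsGT_zero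
  simp only [Real.rpow_neg_eq_inv_rpow] at h
  simpa only [inv_inv] using inv_isLittleO_of_inv_isLittleO_rpow ha hk_inv hf h

lemma rpow_neg_half_sq {a : ℝ} (ha : 0 ≤ a) : (a ^ (-(1 / 2) : ℝ)) ^ 2 = a⁻¹ := by
  rw [← Real.rpow_natCast, ← Real.rpow_mul ha, ← Real.rpow_neg_one]
  norm_num

lemma rpow_neg_half_eq {a : ℝ} (ha : 0 ≤ a) : a ^ (-(1 / 2) : ℝ) = (√a)⁻¹ := by
  rw [Real.rpow_neg ha, Real.sqrt_eq_rpow]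

lemma rpow_neg_half_isBigO_sqrt {α : ℕ → ℝ} (hα : ∀ T, 0 < α T)
    (h : (fun T : ℕ => (T : ℝ)⁻¹) =O[atTop] α) :
    (fun T : ℕ => (T : ℝ) ^ (-(1 / 2) : ℝ)) =O[atTop] fun T => √(α T) := by
  refine IsBigO.of_pow two_ne_zero (h.congr (fun T => ?_) fun T => ?_)
  · exact (rpow_neg_half_sq (Nat.cast_nonneg T)).symm
  · exact (Real.sq_sqrt (hα T).le).symm

lemma tendsto_zero_of_rates {α₁ α₂ : ℕ → ℝ} {κ : ℝ} (hκ : 0 < κ) (hα₁ : ∀ T, 0 < α₁ T)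
    (hα₂ : ∀ T, 0 < α₂ T) (hT : (fun T : ℕ => (T : ℝ)⁻¹) =O[atTop] α₁) (h₁₂ : α₁ =o[atTop] α₂)
    (h₂ : Tendsto α₂ atTop (𝓝 0)) :
    Tendsto (fun T : ℕ => (T : ℝ)⁻¹ * α₁ T ^ (-(1 / 2) : ℝ) * α₂ T ^ (-(1 / 2) : ℝ) +
      (α₁ T * (α₂ T)⁻¹ + α₂ T ^ κ)) atTop (𝓝 0) := by
  have hratio : Tendsto (fun T => α₁ T * (α₂ T)⁻¹) atTop (𝓝 0) := h₁₂.tendsto_div_nhds_zero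
  have hstoch : Tendsto (fun T : ℕ => (T : ℝ)⁻¹ * α₁ T ^ (-(1 / 2) : ℝ) * α₂ T ^ (-(1 / 2) : ℝ))
      atTop (𝓝 0) := by
    have hroot : (fun T => α₁ T * (α₁ T ^ (-(1 / 2) : ℝ) * α₂ T ^ (-(1 / 2) : ℝ))) =
        fun T => √(α₁ T * (α₂ T)⁻¹) := by
      funext T
      rw [rpow_neg_half_eq (hα₁ T).le, rpow_neg_half_eq (hα₂ T).le, ← mul_assoc,
        ← div_eq_mul_inv (α₁ T), Real.div_sqrt, Real.sqrt_mul (hα₁ T).le, Real.sqrt_inv]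
    have hO := hT.mul (isBigO_refl (fun T => α₁ T ^ (-(1 / 2) : ℝ) * α₂ T ^ (-(1 / 2) : ℝ)) atTop)
    rw [hroot] at hO
    simpa only [mul_assoc] using hO.trans_tendsto (by simpa using hratio.sqrt)
  have htail : Tendsto (fun T => α₂ T ^ κ) atTop (𝓝 0) := by
    simpa [Real.zero_rpow hκ.ne'] using h₂.rpow_const (p := κ) (.inr hκ.le)
  simpa using hstoch.add (hratio.add htail)

end Rates

section Model

variable {H : Type*} [NormedAddCommGroup H] [InnerProductSpace ℝ H] [CompleteSpace H]
  {Ω : Type*}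

lemma tendsto_sampleQ_basis (x z : ℕ → Ω → H) (α₁ : ℕ → ℝ) (μh : ℕ → Ω → ℕ → ℝ)
    (gh : ℕ → Ω → HilbertBasis ℕ ℝ H) (T : ℕ) (ω : Ω) (e : HilbertBasis ℕ ℝ H) :
    Tendsto (fun j => sampleQ x z α₁ μh gh T ω (e j)) atTop (𝓝 0) := by
  have hcont := ((sampleOp x z T ω)† ∘L
    regInv (μh T ω) (gh T ω) (truncCount (μh T ω) (α₁ T))).continuous.tendsto 0
  rw [map_zero] at hcont
  exact hcont.comp (tendsto_sampleOp_basis x z T ω e)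

lemma f2slse_sub_eq (x y z : ℕ → Ω → H) (A : H →L[ℝ] H) (α₁ α₂ : ℕ → ℝ) (μh : ℕ → Ω → ℕ → ℝ)
    (gh : ℕ → Ω → HilbertBasis ℕ ℝ H) (νh : ℕ → Ω → ℕ → ℝ) (hh : ℕ → Ω → HilbertBasis ℕ ℝ H)
    {T : ℕ} {ω : Ω} (hQ : IsEigensystem (sampleQ x z α₁ μh gh T ω) (νh T ω) (hh T ω))
    (hν : ∀ j < truncCount (νh T ω) (α₂ T), νh T ω j ≠ 0) :
    f2slse x y z α₁ α₂ μh gh νh hh T ω - A ∘L projTilde α₂ νh hh T ω =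
      (sampleOp (resid A x y) z T ω)† ∘L
        regInv (μh T ω) (gh T ω) (truncCount (μh T ω) (α₁ T)) ∘L sampleOp x z T ω ∘L
          regInv (νh T ω) (hh T ω) (truncCount (νh T ω) (α₂ T)) := by
  have hyz : (sampleOp y z T ω)† = A ∘L (sampleOp x z T ω)† + (sampleOp (resid A x y) z T ω)† := by
    rw [sampleOp_eq_comp_adjoint_add A x y z T ω, map_add, ContinuousLinearMap.adjoint_comp,
      ContinuousLinearMap.adjoint_adjoint]
  rw [projTilde, ← hQ.comp_regInv hν, f2slse, sampleP, sampleQ, hyz]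
  ext v
  simp

variable [MeasurableSpace Ω] {P : Measure Ω} {x y z : ℕ → Ω → H} {A B C : H →L[ℝ] H}
  {α₁ α₂ : ℕ → ℝ} {μh νh : ℕ → Ω → ℕ → ℝ} {gh hh : ℕ → Ω → HilbertBasis ℕ ℝ H}

lemma isBigOp_norm_f2slse_sub_sq
    (hU : IsBigOp P (fun T ω => ‖sampleOp (resid A x y) z T ω‖ₑ) fun T => (T : ℝ) ^ (-(1 / 2) : ℝ))
    (hα₁ : ∀ T, 0 < α₁ T) (hα₂ : ∀ T, 0 < α₂ T)
    (hzz : ∀ T ω, IsEigensystem (sampleOp z z T ω) (μh T ω) (gh T ω))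
    (hQ : ∀ T ω, IsEigensystem (sampleQ x z α₁ μh gh T ω) (νh T ω) (hh T ω)) :
    IsBigOp P
      (fun T ω => ‖f2slse x y z α₁ α₂ μh gh νh hh T ω - A ∘L projTilde α₂ νh hh T ω‖ₑ ^ 2)
      (fun T => (T : ℝ)⁻¹ * (α₁ T) ^ (-(1 / 2) : ℝ) * (α₂ T) ^ (-(1 / 2) : ℝ)) := by
  refine hU.imp (fun T => by positivity) fun M hM => ⟨M ^ 2, .of_forall fun T ω hω => ?_⟩
  have ht₁ := Real.sqrt_pos.2 (hα₁ T)
  have ht₂ := Real.sqrt_pos.2 (hα₂ T)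
  have hμ : ∀ j < truncCount (μh T ω) (α₁ T), √(α₁ T) ≤ μh T ω j := fun j =>
    sqrt_le_of_lt_truncCount (hzz T ω).antitone
      ((hzz T ω).tendsto_zero (tendsto_sampleOp_basis _ _ _ _ _)) (hα₁ T)
  have hν : ∀ j < truncCount (νh T ω) (α₂ T), √(α₂ T) ≤ νh T ω j := fun j =>
    sqrt_le_of_lt_truncCount (hQ T ω).antitone
      ((hQ T ω).tendsto_zero (tendsto_sampleQ_basis _ _ _ _ _ _ _ _)) (hα₂ T)
  rw [enorm_le_ofReal_iff (by positivity)] at hω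
  rw [rpow_neg_half_eq (hα₁ T).le, rpow_neg_half_eq (hα₂ T).le,
    enorm_sq_le_ofReal_iff (by positivity),
    f2slse_sub_eq x y z A α₁ α₂ μh gh νh hh (hQ T ω) fun j hj => (ht₂.trans_le (hν j hj)).ne']
  calc _ ≤ ‖sampleOp (resid A x y) z T ω‖ ^ 2 * ((√(α₁ T))⁻¹ * (√(α₂ T))⁻¹) :=
        norm_stochastic_error_sq_le _ _ (hQ T ω) ht₁ ht₂ hμ hν
    _ ≤ (M * (T : ℝ) ^ (-(1 / 2) : ℝ)) ^ 2 * ((√(α₁ T))⁻¹ * (√(α₂ T))⁻¹) := by gcongr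
    _ = M ^ 2 * ((T : ℝ)⁻¹ * (√(α₁ T))⁻¹ * (√(α₂ T))⁻¹) := by
        rw [mul_pow, rpow_neg_half_sq (Nat.cast_nonneg T)]; ring

lemma isBigOp_norm_sampleQ_sub (hα₁ : ∀ T, 0 < α₁ T)
    (hD : IsBigOp P (fun T ω => ‖sampleOp z z T ω - C‖ₑ) fun T => √(α₁ T))
    (hV : IsBigOp P (fun T ω => ‖sampleOp (resid B z x) z T ω‖ₑ) fun T => √(α₁ T))
    (hzz : ∀ T ω, IsEigensystem (sampleOp z z T ω) (μh T ω) (gh T ω)) :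
    IsBigOp P (fun T ω => ‖sampleQ x z α₁ μh gh T ω - B ∘L C ∘L B†‖ₑ) fun T => √(α₁ T) := by
  refine hD.imp₂ hV (fun T => Real.sqrt_nonneg _) (fun T => Real.sqrt_nonneg _) fun M hM =>
    ⟨‖B‖ ^ 2 * (M + 1) + 2 * ‖B‖ * M + M ^ 2, .of_forall fun T ω hDω hVω => ?_⟩
  have ht := Real.sqrt_pos.2 (hα₁ T)
  have hμ0 := (hzz T ω).tendsto_zero (tendsto_sampleOp_basis _ _ _ _ _)
  rw [enorm_le_ofReal_iff (by positivity)] at hDω hVω ⊢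
  rw [sampleQ, sampleOp_eq_comp_adjoint_add B z x z T ω]
  refine (norm_first_stage_sub_le B C _ (hzz T ω) ht
    (fun j => sqrt_le_of_lt_truncCount (hzz T ω).antitone hμ0 (hα₁ T))
    fun j => abs_le_sqrt_of_truncCount_le (hzz T ω).antitone hμ0 (hα₁ T)).trans ?_
  set t := √(α₁ T)
  calc _ ≤ ‖B‖ ^ 2 * (M * t + t) + 2 * ‖B‖ * (M * t) + (M * t) ^ 2 * t⁻¹ := by gcongr
    _ = (‖B‖ ^ 2 * (M + 1) + 2 * ‖B‖ * M + M ^ 2) * t := by field_simp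

/-- The threshold `4 α` for the population eigenvalues is twice the sample threshold `√α` on the
scale of the eigenvalues themselves; this is the separation that Davis–Kahan needs. -/
lemma isBigOp_norm_comp_compl_firstProj_sq {Q : H →L[ℝ] H} {Qh : ℕ → Ω → H →L[ℝ] H} {ν : ℕ → ℝ}
    {h : HilbertBasis ℕ ℝ H} {α r : ℕ → ℝ} {k c ρ γ ς : ℝ} (hr : ∀ T, 0 ≤ r T)
    (hQh : IsBigOp P (fun T ω => ‖Qh T ω - Q‖ₑ) r) (hα : ∀ T, 0 < α T)
    (hQ : IsEigensystem Q ν h) (hν0 : Tendsto ν atTop (𝓝 0))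
    (hQhe : ∀ T ω, IsEigensystem (Qh T ω) (νh T ω) (hh T ω))
    (hνh0 : ∀ T ω, Tendsto (νh T ω) atTop (𝓝 0)) (hk : 0 < k) (hρ : 0 < ρ)
    (hgap : ∀ j : ℕ, k * ((j : ℝ) + 1) ^ (-ρ - 1) ≤ ν j ^ 2 - ν (j + 1) ^ 2)
    (hγ : 1 / 2 < γ) (hς : 1 / 2 < ς)
    (hA : ∀ j l : ℕ, |⟪h j, A (h l)⟫| ≤ c * ((j : ℝ) + 1) ^ (-γ) * ((l : ℝ) + 1) ^ (-ς)) :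
    IsBigOp P (fun T ω => ‖A ∘L (ContinuousLinearMap.id ℝ H -
        firstProj (hh T ω) (truncCount (νh T ω) (α T)))‖ₑ ^ 2)
      (fun T => r T ^ 2 * (α T)⁻¹ + α T ^ ((2 * ς - 1) / ρ)) := by
  obtain ⟨C, hC0, hC⟩ :=
    exists_norm_comp_compl_truncCount_sq_le A h hQ.antitone hν0 hk hρ hgap hγ hς hA
  set κ := (2 * ς - 1) / ρ
  refine hQh.imp hr fun M hM =>
    ⟨2 * (‖A‖ ^ 2 * M ^ 2 + C * 4 ^ κ), .of_forall fun T ω hω => ?_⟩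
  have ha := hα T
  have ht := Real.sqrt_pos.2 ha
  have hMr := mul_nonneg hM (hr T)
  rw [enorm_le_ofReal_iff hMr] at hω
  rw [enorm_sq_le_ofReal_iff (by have := hr T; positivity)]
  have hsqrt : √(4 * α T) = 2 * √(α T) := by
    rw [Real.sqrt_mul (by norm_num), show (4 : ℝ) = 2 ^ 2 by norm_num, Real.sqrt_sq (by norm_num)]
  have hbias := norm_comp_compl_firstProj_le_add hQ (hQhe T ω) ht
    (fun j hj => hsqrt ▸ sqrt_le_of_lt_truncCount hQ.antitone hν0 (by positivity) hj)
    (fun j => abs_le_sqrt_of_truncCount_le (hQhe T ω).antitone (hνh0 T ω) ha) A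
  have htail := hC (4 * α T) (by positivity)
  set τ := ‖A ∘L (ContinuousLinearMap.id ℝ H - firstProj h (truncCount ν (4 * α T)))‖
  calc _ ≤ (‖A‖ * (M * r T / √(α T)) + τ) ^ 2 := by gcongr; exact hbias.trans (by gcongr)
    _ ≤ 2 * ((‖A‖ * (M * r T / √(α T))) ^ 2 + τ ^ 2) := add_sq_le
    _ ≤ 2 * ((‖A‖ * (M * r T / √(α T))) ^ 2 + C * (4 * α T) ^ κ) := by gcongr
    _ = 2 * (‖A‖ ^ 2 * M ^ 2 * (r T ^ 2 * (α T)⁻¹) + C * 4 ^ κ * α T ^ κ) := by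
        rw [mul_pow, div_pow, mul_pow, Real.sq_sqrt ha.le, Real.mul_rpow (by norm_num) ha.le]
        ring
    _ ≤ 2 * (‖A‖ ^ 2 * M ^ 2 + C * 4 ^ κ) * (r T ^ 2 * (α T)⁻¹ + α T ^ κ) := by
        have : 0 ≤ ‖A‖ ^ 2 * M ^ 2 * α T ^ κ := by positivity
        have : 0 ≤ C * 4 ^ κ * (r T ^ 2 * (α T)⁻¹) := by positivity
        linarith

lemma BasicAssumption.momentOp_uz_eq_zero [MeasurableSpace H] [BorelSpace H]
    [SecondCountableTopology H] [IsFiniteMeasure P] {μ ν : ℕ → ℝ} {g h : HilbertBasis ℕ ℝ H}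
    (hb : BasicAssumption P x y z A B μ g ν h) : momentOp P (resid A x y 0) (z 0) = 0 := by
  have hu : ∀ t, Measurable (resid A x y t) := fun t =>
    (hb.measurable_y t).sub (A.continuous.measurable.comp (hb.measurable_x t))
  have hm : pastInfo z (resid A x y) 0 ≤ ‹MeasurableSpace Ω› :=
    sup_le (iSup₂_le fun s _ => (hb.measurable_z s).comap_le)
      (iSup₂_le fun s _ => (hu s).comap_le)
  have hz : Measurable[pastInfo z (resid A x y) 0] (z 0) :=
    measurable_iff_comap_le.2 (le_sup_of_le_left
      (le_iSup₂_of_le (f := fun s (_ : s ∈ Set.Iic 0) =>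
        MeasurableSpace.comap (z s) inferInstance) 0 (Set.mem_Iic.2 le_rfl) le_rfl))
  exact momentOp_eq_zero_of_condExp_eq_zero hm (hb.memLp_u 0) (hb.memLp_z 0) hz.stronglyMeasurable
    (hb.martingale_diff 0)

end Model

end FIV

open FIV in
theorem theorem7_general {H : Type*} [NormedAddCommGroup H] [InnerProductSpace ℝ H]
    [CompleteSpace H] {Ω : Type*} [MeasurableSpace Ω] (P : Measure Ω)
    (x y z : ℕ → Ω → H) (A B : H →L[ℝ] H)
    (μ : ℕ → ℝ) (g : HilbertBasis ℕ ℝ H) (ν : ℕ → ℝ) (h : HilbertBasis ℕ ℝ H)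
    (hx : MemLp (x 0) 2 P) (hz : MemLp (z 0) 2 P)
    (hv : momentOp P (z 0) (resid B z x 0) = 0)
    (eigen_zz : IsEigensystem (momentOp P (z 0) (z 0)) μ g) (hμ : ∀ j, μ j ≠ 0)
    (eigen_Q : IsEigensystem (popQ (momentOp P (x 0) (z 0)) μ g) ν h)
    (rate_zz : IsBigOp P (fun T ω => ‖sampleOp z z T ω - momentOp P (z 0) (z 0)‖ₑ)
      (fun T => (T : ℝ) ^ (-(1 / 2) : ℝ)))
    (rate_uz : IsBigOp P (fun T ω => ‖sampleOp (resid A x y) z T ω‖ₑ)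
      (fun T => (T : ℝ) ^ (-(1 / 2) : ℝ)))
    (rate_vz : IsBigOp P (fun T ω => ‖sampleOp (resid B z x) z T ω‖ₑ)
      (fun T => (T : ℝ) ^ (-(1 / 2) : ℝ)))
    {k c ρ γ ς : ℝ} (hk : 0 < k) (hρ : 0 < ρ) (hγ : 1 / 2 < γ) (hς : 1 / 2 < ς)
    (gap : ∀ j : ℕ, k * ((j : ℝ) + 1) ^ (-ρ - 1) ≤ ν j ^ 2 - ν (j + 1) ^ 2)
    (smooth : ∀ j l : ℕ, |⟪h j, A (h l)⟫| ≤ c * ((j : ℝ) + 1) ^ (-γ) * ((l : ℝ) + 1) ^ (-ς))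
    (α₁ α₂ : ℕ → ℝ) (hα₁ : ∀ T, 0 < α₁ T) (hα₂ : ∀ T, 0 < α₂ T)
    (hT : (fun T : ℕ => (T : ℝ)⁻¹) =O[atTop] α₁) (h₁₂ : α₁ =o[atTop] α₂)
    (hα₂_lim : Tendsto α₂ atTop (𝓝 0))
    (μh : ℕ → Ω → ℕ → ℝ) (gh : ℕ → Ω → HilbertBasis ℕ ℝ H)
    (hzz : ∀ T ω, IsEigensystem (sampleOp z z T ω) (μh T ω) (gh T ω))
    (νh : ℕ → Ω → ℕ → ℝ) (hh : ℕ → Ω → HilbertBasis ℕ ℝ H)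
    (hQ : ∀ T ω, IsEigensystem (sampleQ x z α₁ μh gh T ω) (νh T ω) (hh T ω)) :
    IsBigOp P
      (fun T ω => ‖f2slse x y z α₁ α₂ μh gh νh hh T ω -
        A ∘L projTilde α₂ νh hh T ω‖ₑ ^ 2)
      (fun T => (T : ℝ)⁻¹ * (α₁ T) ^ (-(1 / 2) : ℝ) * (α₂ T) ^ (-(1 / 2) : ℝ)) ∧
    IsBigOp P
      (fun T ω => ‖A ∘L (ContinuousLinearMap.id ℝ H - projTilde α₂ νh hh T ω)‖ₑ ^ 2)
      (fun T => α₁ T * (α₂ T)⁻¹ + (α₂ T) ^ ((2 * ς - 1) / ρ)) ∧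
    TendstoInMeasure P (f2slse x y z α₁ α₂ μh gh νh hh) atTop (fun _ => A) := by
  have hsqrt₁ := rpow_neg_half_isBigO_sqrt hα₁ hT
  have hΔ := isBigOp_norm_sampleQ_sub hα₁
    (rate_zz.trans_isBigO (fun T => by positivity) (fun T => by positivity) hsqrt₁)
    (rate_vz.trans_isBigO (fun T => by positivity) (fun T => by positivity) hsqrt₁) hzz
  rw [← popQ_momentOp_eq hx hz hv eigen_zz.isDiag hμ] at hΔ
  have hstoch := isBigOp_norm_f2slse_sub_sq (A := A) rate_uz hα₁ hα₂ hzz hQ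
  have hbias := isBigOp_norm_comp_compl_firstProj_sq (A := A) (fun T => by positivity) hΔ hα₂
    eigen_Q (tendsto_eigenvalues_popQ hx hz hv eigen_zz.isDiag hμ eigen_Q.isDiag) hQ
    (fun T ω => (hQ T ω).tendsto_zero (tendsto_sampleQ_basis x z α₁ μh gh T ω _))
    hk hρ gap hγ hς smooth
  simp only [Real.sq_sqrt (hα₁ _).le] at hbias
  refine ⟨hstoch, hbias, ?_⟩
  have hsum := hstoch.sub_sq hbias
    (fun T => by have := (hα₁ T).le; have := (hα₂ T).le; positivity)
    (fun T => by have := (hα₁ T).le; have := (hα₂ T).le; positivity)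
  refine IsBigOp.tendstoInMeasure (hsum.mono fun T ω => le_of_eq ?_)
    (tendsto_zero_of_rates (div_pos (by linarith) hρ) hα₁ hα₂ hT h₁₂ hα₂_lim)
  simp [projTilde, ContinuousLinearMap.comp_sub]

theorem theorem7 {H : Type*} [NormedAddCommGroup H] [InnerProductSpace ℝ H] [CompleteSpace H]
    [SecondCountableTopology H] [MeasurableSpace H] [BorelSpace H]
    {Ω : Type*} [MeasurableSpace Ω] (P : Measure Ω) [IsProbabilityMeasure P]
    (x y z : ℕ → Ω → H) (A B : H →L[ℝ] H)
    (μ : ℕ → ℝ) (g : HilbertBasis ℕ ℝ H) (ν : ℕ → ℝ) (h : HilbertBasis ℕ ℝ H)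
    (c ρμ ρν ςμ ςν γμ γν m : ℝ)
    (hass : FIV.RateAssumption P x y z A B μ g ν h c ρμ ρν ςμ ςν γμ γν m)
    -- the regularization parameters
    (α₁ α₂ : ℕ → ℝ) (hα₁_pos : ∀ T, 0 < α₁ T) (hα₂_pos : ∀ T, 0 < α₂ T)
    (hα₁_lim : Tendsto α₁ atTop (𝓝 0)) (hα₂_lim : Tendsto α₂ atTop (𝓝 0))
    (hα₁_rate : (fun T : ℕ => (α₁ T)⁻¹) =o[atTop] fun T : ℕ => (T : ℝ) ^ (ρμ / (2 * ρμ + 2)))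
    (hα₂_rate : (fun T : ℕ => (α₂ T)⁻¹) =o[atTop] fun T : ℕ => (α₁ T) ^ (-ρν / (2 * ρν + 2)))
    -- the eigenelements of the sample operators
    (μh : ℕ → Ω → ℕ → ℝ) (gh : ℕ → Ω → HilbertBasis ℕ ℝ H)
    (hzz : ∀ T ω, FIV.IsEigensystem (FIV.sampleOp z z T ω) (μh T ω) (gh T ω))
    (νh : ℕ → Ω → ℕ → ℝ) (hh : ℕ → Ω → HilbertBasis ℕ ℝ H)
    (hQ : ∀ T ω, FIV.IsEigensystem (FIV.sampleQ x z α₁ μh gh T ω) (νh T ω) (hh T ω)) :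
    FIV.IsBigOp P
      (fun T ω => ‖FIV.f2slse x y z α₁ α₂ μh gh νh hh T ω -
        A ∘L FIV.projTilde α₂ νh hh T ω‖ₑ ^ 2)
      (fun T => (T : ℝ)⁻¹ * (α₁ T) ^ (-(1 / 2) : ℝ) * (α₂ T) ^ (-(1 / 2) : ℝ)) ∧
    FIV.IsBigOp P
      (fun T ω => ‖A ∘L (ContinuousLinearMap.id ℝ H - FIV.projTilde α₂ νh hh T ω)‖ₑ ^ 2)
      (fun T => α₁ T * (α₂ T)⁻¹ * max 1 ((α₂ T) ^ ((2 * ςν - 3) / ρν)) +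
        (α₂ T) ^ ((2 * ςν - 1) / ρν)) ∧
    TendstoInMeasure P (FIV.f2slse x y z α₁ α₂ μh gh νh hh) atTop (fun _ => A) := by
  have hρ_le {ρ : ℝ} (hρ : 2 < ρ) : ρ / (2 * ρ + 2) ≤ 1 :=
    (div_le_one (by linarith)).2 (by linarith)
  have hratio (T : ℕ) : 0 ≤ α₁ T * (α₂ T)⁻¹ :=
    mul_nonneg (hα₁_pos T).le (inv_nonneg.2 (hα₂_pos T).le)
  obtain ⟨hstoch, hbias, hconv⟩ := theorem7_general P x y z A B μ g ν h (hass.memLp_x 0)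
    (hass.memLp_z 0) (hass.first_stage 0) hass.eigen_zz (fun j => (hass.pos_μ j).ne') hass.eigen_Q
    (hass.rate_zz.mono fun T ω => FIV.enorm_le_hsNorm _ g)
    (hass.rate_uz.mono fun T ω => by
      simpa [hass.momentOp_uz_eq_zero] using FIV.enorm_le_hsNorm _ g)
    (hass.rate_vz.mono fun T ω => FIV.enorm_le_hsNorm _ g)
    (inv_pos.2 hass.c_pos) (by linarith [hass.hρν]) hass.hγν hass.hςν hass.gap_ν hass.smooth_A
    α₁ α₂ hα₁_pos hα₂_pos
    (FIV.inv_isLittleO_of_inv_isLittleO_rpow (hρ_le hass.hρμ) tendsto_natCast_atTop_atTop hα₁_pos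
      hα₁_rate).isBigO
    (FIV.isLittleO_of_inv_isLittleO_rpow_neg (hρ_le hass.hρν) hα₁_lim hα₁_pos hα₂_pos
      (by simpa only [neg_div] using hα₂_rate))
    hα₂_lim μh gh hzz νh hh hQ
  exact ⟨hstoch, hbias.mono_rate
    (fun T => add_nonneg (hratio T) (Real.rpow_nonneg (hα₂_pos T).le _))
    fun T => add_le_add_left (le_mul_of_one_le_right (hratio T) (le_max_left _ _)) _, hconv⟩
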